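/- **Setting.** Fix $m,n\ge 1$. An agenda on $m$ issues is a set $\mathbb X\subseteq\{0,1\}^m$ of "consistent" opinions. A (consistent) profile is $X=(X_1,\dots,X_n)\in\mathbb X^n$, where $X_i$ is the opinion of voter $i$; $X^j\in\{0,1\}^n$ denotes the vector of votes on issue $j$. An aggregation mechanism is a map $F:(\{0,1\}^m)^n\to\{0,1\}^m$. It is *consistent* if $F(X)\in\mathbb X$ for all $X\in\mathbb X^n$, and *independent* if, for all $X,Y\in\mathbb X^n$ and every issue $j$, $X^j=Y^j$ implies $F(X)^j=F(Y)^j$. All probabilities below are over uniformly random profiles in $\mathbb X^n$. Put $$d(F,G)=\Pr_{X}[F(X)\ne G(X)],\qquad IC(F)=\Pr_X[F(X)\notin\mathbb X],$$ $$DI(F)=\max_{1\le j\le m}\ \mathbb E_{X}\Big[\Pr_{Y}\big[F(X)^j\ne F(Y)^j\,\big|\,X^j=Y^j\big]\Big].$$ $F$ is *$\delta$-consistent* if $IC(F)\le\delta$ (equivalently, if $d(F,H)\le\delta$ for some consistent $H$). $F$ is *$\delta$-independent* if $DI(F)\le\delta$ or $d(F,H)\le\delta$ for some independent mechanism $H$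 (the theorem thus holds for either of these two versions of the notion). $\mathbb X$ is *truth-functional* if the issues are divided into premises and conclusions and, for some Boolean functions $\Phi^j$ of the premises, $\mathbb X=\{x\in\{0,1\}^m : x^j=\Phi^j(\text{the premise coordinates of }x)\text{ for every conclusion }j\}$. Let $\mathcal A_m$ be the class of the truth-functional agendas on $m$ issues in which every $\Phi^j$ is a conjunction or a xor of a non-empty set of premises, up to negating some of the inputs and possibly the output. For $\varepsilon,\delta_{IC},\delta_{DI}\in\mathbb R$ let $\mathcal R(m,n,\varepsilon,\delta_{IC},\delta_{DI})$ be the assertion: for every $\mathbb X\in\mathcal A_m$ and every aggregation mechanism $F$ for $n$ voters that is $\delta_{IC}$-consistent and $\delta_{DI}$-independent, there is a consistent and independent aggregation mechanism $G$ with $d(F,G)<\varepsilon$. **Theorem.** 1. There is a polynomial $p$ with natural number coefficients such that for all $\varepsilon>0$ and $m,n\ge1$, $\mathcal R(m,n,\varepsilon,\delta,\delta)$ holds with $\delta=n^{-2}\left(\frac{\varepsilon}{m}\right)^{p(m)}$. 2. Moreover, for all $\varepsilon>0$, $m,n\ge1$ and every $\beta\in\left[0,\;n^{-2}\left(\frac{\varepsilon}{m}\right)^{m^2+m-1}\right]$,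 $\mathcal R(m,n,\varepsilon,\delta_{IC},\delta_{DI})$ holds with $$\delta_{IC}=n^{-2}\left(\frac{(1-\beta)\varepsilon}{5m}\right)^{m^2+m-1}-\beta\varepsilon,\qquad \delta_{DI}=\frac{1}{2m}\,\beta\,\varepsilon .$$ -/

import Mathlib

namespace JudgementAggregation

/-- An opinion on `m` binary issues: an answer to each issue. -/
abbrev Opinion (m : ℕ) : Type := Fin m → Bool

/-- A profile of `n` voters: `X i j` is the vote of voter `i` on issue `j`. -/
abbrev Profile (m n : ℕ) : Type := Fin n → Opinion m

/-- An agenda on `m` issues: the set of the opinions that are considered consistent. -/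
abbrev Agenda (m : ℕ) : Type := Finset (Opinion m)

/-- An aggregation mechanism: it assigns an aggregated opinion, consistent or not, to every
profile. -/
abbrev Mechanism (m n : ℕ) : Type := Profile m n → Opinion m

/-- The profiles in which every voter holds a consistent opinion. -/
def profiles {m : ℕ} (A : Agenda m) (n : ℕ) : Finset (Profile m n) :=
  Fintype.piFinset fun _ => A

open Classical in
/-- The probability of the event `E` under the uniform distribution on the finite set `S`. -/
noncomputable def uniformProb {α : Type*} (S : Finset α) (E : α → Prop) : ℝ :=
  ((S.filter E).card : ℝ) / (S.card : ℝ)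

/-- The distance `d(F, G)`: the probability that `F` and `G` differ on a uniformly random
consistent profile. -/
noncomputable def mechDist {m n : ℕ} (A : Agenda m) (F G : Mechanism m n) : ℝ :=
  uniformProb (profiles A n) fun X => F X ≠ G X

/-- Consistency: consistent profiles are mapped to consistent opinions. -/
def IsConsistent {m n : ℕ} (A : Agenda m) (F : Mechanism m n) : Prop :=
  ∀ X ∈ profiles A n, F X ∈ A

/-- Independence: on consistent profiles, the aggregated answer to an issue depends only on the
votes on that issue. -/
def IsIndependent {m n : ℕ} (A : Agenda m) (F : Mechanism m n) : Prop :=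
  ∀ X ∈ profiles A n, ∀ Y ∈ profiles A n, ∀ j : Fin m,
    (∀ i, X i j = Y i j) → F X j = F Y j

/-- The inconsistency index `IC(F)`. -/
noncomputable def inconsistencyIndex {m n : ℕ} (A : Agenda m) (F : Mechanism m n) : ℝ :=
  uniformProb (profiles A n) fun X => F X ∉ A

/-- The dependency index of issue `j`: the average, over a uniformly random consistent profile
`X`, of the conditional probability that `F Y` and `F X` differ on issue `j`, where `Y` is a
uniformly random consistent profile that agrees with `X` on issue `j`. -/
noncomputable def issueDependencyIndex {m n : ℕ} (A : Agenda m) (F : Mechanism m n)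
    (j : Fin m) : ℝ :=
  (∑ X ∈ profiles A n,
    uniformProb ((profiles A n).filter fun Y => ∀ i, X i j = Y i j) fun Y => F X j ≠ F Y j) /
      ((profiles A n).card : ℝ)

/-- The dependency index `DI(F)`: the maximum over the issues (a finite set). -/
noncomputable def dependencyIndex {m n : ℕ} (A : Agenda m) (F : Mechanism m n) : ℝ :=
  ⨆ j : Fin m, issueDependencyIndex A F j

/-- `δ`-consistency: the inconsistency index is at most `δ`. -/
def IsAlmostConsistent {m n : ℕ} (A : Agenda m) (δ : ℝ) (F : Mechanism m n) : Prop :=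
  inconsistencyIndex A F ≤ δ

/-- `δ`-independence, in either of its two usual versions (which agree up to a factor that depends
only on `m`): the dependency index is at most `δ`, or some independent mechanism is within
distance `δ`. -/
def IsAlmostIndependent {m n : ℕ} (A : Agenda m) (δ : ℝ) (F : Mechanism m n) : Prop :=
  dependencyIndex A F ≤ δ ∨ ∃ H : Mechanism m n, IsIndependent A H ∧ mechDist A F H ≤ δ

/-- `φ` is a conjunction of some of its inputs (at least one), up to negating inputs (those with
`neg i = true`) and the output (if `out = true`). -/
def IsConjunction {ι : Type*} (φ : (ι → Bool) → Bool) : Prop :=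
  ∃ (S : Finset ι) (neg : ι → Bool) (out : Bool), S.Nonempty ∧
    ∀ y, φ y = (out ^^ decide (∀ i ∈ S, (neg i ^^ y i) = true))

/-- `φ` is a xor of some of its inputs (at least one), up to negating inputs (those with
`neg i = true`) and the output (if `out = true`). -/
def IsXor {ι : Type*} (φ : (ι → Bool) → Bool) : Prop :=
  ∃ (S : Finset ι) (neg : ι → Bool) (out : Bool), S.Nonempty ∧
    ∀ y, φ y = (out ^^ decide (Odd (S.filter fun i => (neg i ^^ y i) = true).card))

/-- `A` is a truth-functional agenda: the issues are divided into premises (the set `P`) and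
conclusions, and an opinion is consistent iff its answer to each conclusion `j` is `Φ j` applied
to its answers to the premises. Here every `Φ j` is a conjunction or a xor of premises, up to
negating inputs or output. -/
def IsConjXorAgenda {m : ℕ} (A : Agenda m) : Prop :=
  ∃ (P : Finset (Fin m)) (Φ : Fin m → ({i // i ∈ P} → Bool) → Bool),
    (∀ j, j ∉ P → IsConjunction (Φ j) ∨ IsXor (Φ j)) ∧
      ∀ x : Opinion m, x ∈ A ↔ ∀ j, j ∉ P → x j = Φ j fun i => x i

end JudgementAggregation

/-!
An independent mechanism `H` is given by one Boolean function `f j` of the votes on each issue `j`.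
The votes on the premises are independent and uniform, so near-consistency says that, for every
conclusion `φ`, the premise functions nearly commute with `φ`: with high probability,
`φ (f i (Yᵢ))` is the value of some function at the votes on `φ (Y)`.

For a conjunction of at least two premises, none of which is nearly constantly rejected, negate the
vote of `v` on one premise in a profile where `v` rejects another premise. The votes on the
conjunction do not change, so the outcome must not either. Hence, if `v` has a noticeable influence
on one premise, then the rejection of any other premise by `v` almost forces its rejection
(`influence_mul_prob_mul_pow_le`). Therefore the influential voters are the same for all premises,
all of them almost have a veto, and since the other voters have little influence, a Poincaré
inequality (`prob_mul_prob_le_of_influence_le`) shows that each premise function is close to the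
conjunction of their votes (`exists_forall_prob_ne_allYes_le`). For a xor, negate the vote of `v` on
two premises at once: every influence is then close to `0` or to `1`, and each premise function is
close to a xor of votes or its negation (`exists_forall_prob_ne_parity_le`). The factor `n⁻²` comes
from summing over the voters twice, in the veto argument and in the Poincaré inequality.

The premise functions are then rounded (`round`). The choice must not depend on the conclusion, as
a premise may occur in several. The set of the influential voters depends on `f i` only, and two
different basic mechanisms on the same set of voters are far apart
(`IsBasic.eq_of_prob_ne_lt`), so there is no conflict. The rounded premises satisfy every conclusion
exactly (`IsConjunction.exists_round_eq`, `IsXor.exists_round_eq`); deriving the conclusions from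
them gives a consistent mechanism that is independent as well
(`exists_mechDist_le_of_isIndependent`).

A nearly independent mechanism is first replaced by the majority outcome over the profiles that
agree on the issue (`IsAlmostIndependent.exists_mechDist_le`).
-/

namespace JudgementAggregation

/-! ### Uniform probabilities on finite sets -/

section Probability

variable {α β : Type*}

lemma uniformProb_eq (S : Finset α) (E : α → Prop) [DecidablePred E] :
    uniformProb S E = ((S.filter E).card : ℝ) / (S.card : ℝ) := by
  unfold uniformProb
  congr!

lemma uniformProb_nonneg (S : Finset α) (E : α → Prop) : 0 ≤ uniformProb S E := by
  unfold uniformProb; positivity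

lemma uniformProb_le_one (S : Finset α) (E : α → Prop) : uniformProb S E ≤ 1 := by
  classical
  rw [uniformProb_eq]
  exact div_le_one_of_le₀ (by exact_mod_cast Finset.card_filter_le _ _) (by positivity)

lemma uniformProb_mono {S : Finset α} {E E' : α → Prop} (h : ∀ x ∈ S, E x → E' x) :
    uniformProb S E ≤ uniformProb S E' := by
  classical
  rw [uniformProb_eq, uniformProb_eq]
  have : (S.filter E).card ≤ (S.filter E').card := by
    apply Finset.card_le_card
    intro x hx
    rw [Finset.mem_filter] at hx ⊢
    exact ⟨hx.1, h x hx.1 hx.2⟩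
  gcongr

lemma uniformProb_congr {S : Finset α} {E E' : α → Prop} (h : ∀ x ∈ S, (E x ↔ E' x)) :
    uniformProb S E = uniformProb S E' :=
  le_antisymm (uniformProb_mono fun x hx => (h x hx).1) (uniformProb_mono fun x hx => (h x hx).2)

lemma uniformProb_or_le (S : Finset α) (E E' : α → Prop) :
    uniformProb S (fun x => E x ∨ E' x) ≤ uniformProb S E + uniformProb S E' := by
  classical
  rw [uniformProb_eq, uniformProb_eq, uniformProb_eq, ← add_div]
  have : (S.filter fun x => E x ∨ E' x).card ≤ (S.filter E).card + (S.filter E').card := by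
    rw [Finset.filter_or]
    exact Finset.card_union_le _ _
  gcongr
  exact_mod_cast this

lemma uniformProb_false (S : Finset α) : uniformProb S (fun _ => False) = 0 := by
  simp [uniformProb]

lemma uniformProb_true {S : Finset α} (hS : S.Nonempty) : uniformProb S (fun _ => True) = 1 := by
  have : (S.card : ℝ) ≠ 0 := by exact_mod_cast hS.card_pos.ne'
  simp [uniformProb, this]

lemma uniformProb_exists_le {ι : Type*} (S : Finset α) (T : Finset ι) (E : ι → α → Prop) :
    uniformProb S (fun x => ∃ i ∈ T, E i x) ≤ ∑ i ∈ T, uniformProb S (E i) := by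
  classical
  induction T using Finset.induction_on with
  | empty => simp [uniformProb_false]
  | insert a T ha ih =>
    rw [Finset.sum_insert ha]
    refine le_trans (le_trans (le_of_eq ?_) (uniformProb_or_le S (E a) fun x => ∃ i ∈ T, E i x))
      (by gcongr)
    exact uniformProb_congr fun x _ => by simp

lemma uniformProb_not {S : Finset α} (hS : S.Nonempty) (E : α → Prop) :
    uniformProb S (fun x => ¬ E x) = 1 - uniformProb S E := by
  classical
  have h0 : (S.card : ℝ) ≠ 0 := by exact_mod_cast hS.card_pos.ne'
  have := Finset.card_filter_add_card_filter_not (s := S) E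
  have h1 : ((S.filter E).card : ℝ) + (S.filter fun x => ¬ E x).card = S.card := by
    exact_mod_cast this
  rw [uniformProb_eq, uniformProb_eq, eq_sub_iff_add_eq, ← add_div, add_comm,
    div_eq_one_iff_eq h0]
  exact h1

lemma uniformProb_of_bijOn {S : Finset α} {T : Finset β} {e : α → β}
    (h : Set.BijOn e S T) (E : β → Prop) :
    uniformProb T E = uniformProb S fun x => E (e x) := by
  classical
  rw [uniformProb_eq, uniformProb_eq]
  have h1 : S.card = T.card := Finset.card_nbij e h.mapsTo h.injOn h.surjOn
  have h2 : (S.filter fun x => E (e x)).card = (T.filter E).card := by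
    refine Finset.card_nbij e ?_ ?_ ?_
    · intro x hx
      simp only [Finset.coe_filter, Set.mem_ofPred_eq] at hx ⊢
      exact ⟨h.mapsTo hx.1, hx.2⟩
    · exact h.injOn.mono fun x hx => by
        simp only [Finset.coe_filter, Set.mem_ofPred_eq] at hx
        exact hx.1
    · intro y hy
      simp only [Finset.coe_filter, Set.mem_ofPred_eq] at hy
      obtain ⟨x, hx, rfl⟩ := h.surjOn hy.1
      exact ⟨x, by simpa using ⟨hx, hy.2⟩, rfl⟩
  rw [h1, h2]

/-- The probability of an event under the uniform distribution on a finite type. -/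
noncomputable def prob [Fintype α] (E : α → Prop) : ℝ := uniformProb Finset.univ E

variable [Fintype α] [Fintype β]

lemma prob_nonneg (E : α → Prop) : 0 ≤ prob E := uniformProb_nonneg _ _

lemma prob_le_one (E : α → Prop) : prob E ≤ 1 := uniformProb_le_one _ _

lemma prob_mono {E E' : α → Prop} (h : ∀ x, E x → E' x) : prob E ≤ prob E' :=
  uniformProb_mono fun x _ => h x

lemma prob_congr {E E' : α → Prop} (h : ∀ x, E x ↔ E' x) : prob E = prob E' :=
  uniformProb_congr fun x _ => h x

lemma prob_or_le (E E' : α → Prop) : prob (fun x => E x ∨ E' x) ≤ prob E + prob E' :=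
  uniformProb_or_le _ _ _

lemma prob_exists_le {ι : Type*} (T : Finset ι) (E : ι → α → Prop) :
    prob (fun x => ∃ i ∈ T, E i x) ≤ ∑ i ∈ T, prob (E i) := uniformProb_exists_le _ _ _

lemma prob_false : prob (fun _ : α => False) = 0 := uniformProb_false _

lemma prob_true [Nonempty α] : prob (fun _ : α => True) = 1 :=
  uniformProb_true Finset.univ_nonempty

lemma prob_not [Nonempty α] (E : α → Prop) : prob (fun x => ¬ E x) = 1 - prob E :=
  uniformProb_not Finset.univ_nonempty _

lemma prob_comp_bijective {e : α → β} (he : Function.Bijective e) (E : β → Prop) :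
    prob (fun x => E (e x)) = prob E :=
  (uniformProb_of_bijOn (by simpa using he) E).symm

lemma prob_pi {ι : Type*} [Fintype ι] [DecidableEq ι] {κ : ι → Type*} [∀ i, Fintype (κ i)]
    (E : ∀ i, κ i → Prop) :
    prob (fun Y : ∀ i, κ i => ∀ i, E i (Y i)) = ∏ i, prob (E i) := by
  classical
  simp only [prob, uniformProb_eq]
  rw [Finset.prod_div_distrib]
  congr 1
  · rw [← Nat.cast_prod, ← Fintype.card_piFinset]
    congr 2
    ext Y
    simp
  · simp [Fintype.card_pi]

lemma prob_prod (E : α → Prop) (E' : β → Prop) :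
    prob (fun p : α × β => E p.1 ∧ E' p.2) = prob E * prob E' := by
  classical
  simp only [prob, uniformProb_eq]
  rw [div_mul_div_comm, ← Nat.cast_mul, ← Nat.cast_mul, ← Finset.card_product,
    ← Finset.card_product]
  congr 3
  · ext; simp

lemma prob_prod_le {E : α → β → Prop} {c : ℝ} (hc : 0 ≤ c)
    (h : ∀ b, prob (fun a => E a b) ≤ c) : prob (fun p : α × β => E p.1 p.2) ≤ c := by
  classical
  have key : ((Finset.univ.filter fun p : α × β => E p.1 p.2).card : ℝ)
      = ∑ b, ((Finset.univ.filter fun a : α => E a b).card : ℝ) := by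
    simp only [Finset.card_filter]
    rw [Fintype.sum_prod_type_right, Nat.cast_sum]
  simp only [prob, uniformProb_eq] at h ⊢
  refine div_le_of_le_mul₀ (by positivity) hc ?_
  have h' : ∀ b, ((Finset.univ.filter fun a : α => E a b).card : ℝ)
      ≤ c * (Finset.univ : Finset α).card := by
    intro b
    rcases (Finset.univ : Finset α).eq_empty_or_nonempty with h0 | h0
    · simp [h0]
    · exact (div_le_iff₀ (by exact_mod_cast h0.card_pos)).1 (h b)
  have := Finset.sum_le_sum fun b (_ : b ∈ (Finset.univ : Finset β)) => h' b
  rw [← key] at this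
  simp only [Finset.sum_const, nsmul_eq_mul] at this
  simp only [Finset.card_univ, Fintype.card_prod, Nat.cast_mul] at this ⊢
  convert this using 1
  ring

end Probability

/-! ### Influences of voters -/

section Influence

variable {n : ℕ}

/-- The vote vector `x` with the vote of voter `v` negated. -/
def flipVote (v : Fin n) (x : Fin n → Bool) : Fin n → Bool := Function.update x v (!x v)

lemma flipVote_flipVote (v : Fin n) (x : Fin n → Bool) : flipVote v (flipVote v x) = x := by
  simp [flipVote]

lemma flipVote_bijective (v : Fin n) : Function.Bijective (flipVote v) :=
  Function.Involutive.bijective (flipVote_flipVote v)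

lemma flipVote_self (v : Fin n) (x : Fin n → Bool) : flipVote v x v = !x v := by
  simp [flipVote]

lemma flipVote_of_ne {v u : Fin n} (h : u ≠ v) (x : Fin n → Bool) : flipVote v x u = x u := by
  simp [flipVote, h]

/-- The vote vector `x` with the votes at which `w` is `true` negated. -/
def shiftVotes (w x : Fin n → Bool) : Fin n → Bool := fun v => w v ^^ x v

lemma shiftVotes_bijective (w : Fin n → Bool) : Function.Bijective (shiftVotes w) :=
  Function.Involutive.bijective fun x => by funext v; simp [shiftVotes]

lemma shiftVotes_shiftVotes_left (w x : Fin n → Bool) :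
    shiftVotes (shiftVotes w x) x = w := by
  funext v; simp [shiftVotes]

/-- The influence of voter `v` on `f`: the probability that negating the vote of `v` changes the
outcome. -/
noncomputable def influence (f : (Fin n → Bool) → Bool) (v : Fin n) : ℝ :=
  prob fun x => f x ≠ f (flipVote v x)

/-- The voters whose influence on `f` exceeds `τ`. -/
noncomputable def influential (τ : ℝ) (f : (Fin n → Bool) → Bool) : Finset (Fin n) :=
  Finset.univ.filter fun v => τ < influence f v

lemma mem_influential {τ : ℝ} {f : (Fin n → Bool) → Bool} {v : Fin n} :
    v ∈ influential τ f ↔ τ < influence f v := by simp [influential]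

lemma influence_nonneg (f : (Fin n → Bool) → Bool) (v : Fin n) : 0 ≤ influence f v :=
  prob_nonneg _

/-- Hybrid argument: negating the votes one after the other. -/
lemma prob_ne_shiftVotes_le (f : (Fin n → Bool) → Bool) (T : Finset (Fin n)) :
    prob (fun x => f x ≠ f (shiftVotes (fun v => decide (v ∈ T)) x))
      ≤ ∑ v ∈ T, influence f v := by
  induction T using Finset.induction_on with
  | empty =>
    have h : ∀ x : Fin n → Bool, shiftVotes (fun v => decide (v ∈ (∅ : Finset (Fin n)))) x = x :=
      fun x => by funext v; simp [shiftVotes]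
    simp only [h, ne_eq, not_true_eq_false, prob_false, Finset.sum_empty, le_refl]
  | insert a T ha ih =>
    rw [Finset.sum_insert ha, add_comm]
    have h1 : influence f a = prob fun x => f (shiftVotes (fun v => decide (v ∈ T)) x)
        ≠ f (flipVote a (shiftVotes (fun v => decide (v ∈ T)) x)) :=
      (prob_comp_bijective (shiftVotes_bijective _) fun x => f x ≠ f (flipVote a x)).symm
    have h2 : ∀ x, shiftVotes (fun v => decide (v ∈ insert a T)) x
        = flipVote a (shiftVotes (fun v => decide (v ∈ T)) x) := by
      intro x
      funext v
      by_cases hv : v = a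
      · subst hv
        simp [shiftVotes, flipVote_self, ha]
      · simp [shiftVotes, flipVote_of_ne hv, hv]
    rw [h1]
    refine le_trans (prob_mono fun x hx => ?_) (le_trans (prob_or_le _ _) (add_le_add_left ih _))
    rw [h2] at hx
    by_contra hcon
    push Not at hcon
    exact hx (hcon.1.trans hcon.2)

/-- The substitution `(x, y) = (x, shiftVotes w x)` for a pair of independent vote vectors. -/
lemma prob_mul_prob_le_of_shiftVotes (E E' : (Fin n → Bool) → Prop) {c : ℝ} (hc : 0 ≤ c)
    (h : ∀ w, prob (fun x => E x ∧ E' (shiftVotes w x)) ≤ c) : prob E * prob E' ≤ c := by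
  rw [← prob_prod]
  have hb : Function.Bijective fun p : (Fin n → Bool) × (Fin n → Bool) =>
      (p.1, shiftVotes p.2 p.1) := by
    refine Function.Involutive.bijective ?_
    rintro ⟨x, w⟩
    simp [shiftVotes_shiftVotes_left]
  rw [← prob_comp_bijective hb]
  exact prob_prod_le (E := fun x w => E x ∧ E' (shiftVotes w x)) hc h

/-- A Poincaré inequality on the subcube where all members of `S` vote `true`: if all other voters
have a small influence, then `f` is nearly constant on the subcube. -/
lemma prob_mul_prob_le_of_influence_le (f : (Fin n → Bool) → Bool) (S : Finset (Fin n)) {c : ℝ}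
    (hc : 0 ≤ c) (h : ∀ v, v ∉ S → influence f v ≤ c) :
    prob (fun x => (∀ v ∈ S, x v = true) ∧ f x = true)
      * prob (fun x => (∀ v ∈ S, x v = true) ∧ f x = false) ≤ n * c := by
  have hnc : (0 : ℝ) ≤ n * c := by positivity
  refine prob_mul_prob_le_of_shiftVotes _ _ hnc fun w => ?_
  by_cases hw : ∀ v ∈ S, w v = false
  · have h1 := prob_ne_shiftVotes_le f (Finset.univ.filter fun v => w v = true)
    have h2 : (fun v => decide (v ∈ Finset.univ.filter fun v => w v = true)) = w := by
      funext v; simp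
    rw [h2] at h1
    have h3 : ∑ v ∈ Finset.univ.filter (fun v => w v = true), influence f v ≤ n * c := by
      calc _ ≤ ∑ v ∈ Finset.univ.filter (fun v => w v = true), c := by
            refine Finset.sum_le_sum fun v hv => h v fun hvS => ?_
            simp [hw v hvS] at hv
        _ ≤ ∑ v : Fin n, c :=
            Finset.sum_le_sum_of_subset_of_nonneg (Finset.subset_univ _) fun _ _ _ => hc
        _ = n * c := by simp
    refine le_trans (prob_mono fun x hx => ?_) (h1.trans h3)
    rw [hx.1.2, hx.2.2]
    simp
  · push Not at hw
    obtain ⟨v, hv, hwv⟩ := hw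
    refine le_trans (prob_mono (E' := fun _ => False) fun x hx => ?_) (by rwa [prob_false])
    have h1 := hx.1.1 v hv
    have h2 := hx.2.1 v hv
    simp [shiftVotes, h1] at h2
    simp [h2] at hwv

/-- The conjunction of the votes of the members of `S` (an oligarchy). -/
def allYes {ι : Type*} (S : Finset ι) (x : ι → Bool) : Bool := decide (∀ v ∈ S, x v = true)

/-- The xor of the votes of the members of `S`. -/
def parity {ι : Type*} (S : Finset ι) (x : ι → Bool) : Bool :=
  decide (Odd (S.filter fun v => x v = true).card)

/-- The embedding of the answers into `ℤ/2ℤ`, which turns xor into addition. -/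
def toZMod (b : Bool) : ZMod 2 := if b then 1 else 0

lemma toZMod_injective : Function.Injective toZMod := by
  intro a b; revert a b; decide

lemma toZMod_xor (a b : Bool) : toZMod (a ^^ b) = toZMod a + toZMod b := by
  revert a b; decide

lemma toZMod_parity {ι : Type*} (S : Finset ι) (x : ι → Bool) :
    toZMod (parity S x) = ∑ v ∈ S, toZMod (x v) := by
  have h : ∑ v ∈ S, toZMod (x v) = ((S.filter fun v => x v = true).card : ZMod 2) := by
    simp [toZMod]
  rw [h]
  unfold toZMod parity
  by_cases ho : Odd (S.filter fun v => x v = true).card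
  · simp [ho, (ZMod.natCast_eq_one_iff_odd).2 ho]
  · rw [Nat.not_odd_iff_even] at ho
    simp [ho, (ZMod.natCast_eq_zero_iff_even).2 ho]

lemma parity_xor {ι : Type*} (S : Finset ι) (x y : ι → Bool) :
    parity S (fun v => x v ^^ y v) = (parity S x ^^ parity S y) := by
  apply toZMod_injective
  simp [toZMod_xor, toZMod_parity, Finset.sum_add_distrib]

lemma parity_comm {ι κ : Type*} (S : Finset ι) (T : Finset κ) (x : ι → κ → Bool) :
    parity S (fun i => parity T (x i)) = parity T fun v => parity S fun i => x i v := by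
  apply toZMod_injective
  simp only [toZMod_parity]
  exact Finset.sum_comm

lemma parity_flipVote (S : Finset (Fin n)) (v : Fin n) (x : Fin n → Bool) :
    parity S (flipVote v x) = (decide (v ∈ S) ^^ parity S x) := by
  have h : flipVote v x = fun u => decide (u = v) ^^ x u := by
    funext u
    by_cases hu : u = v
    · subst hu; simp [flipVote_self]
    · simp [flipVote_of_ne hu, hu]
  rw [h, parity_xor]
  congr 1
  unfold parity
  by_cases hv : v ∈ S
  · simp [hv, Finset.filter_eq']
  · simp [hv, Finset.filter_eq']

lemma prob_parity {S : Finset (Fin n)} (hS : S.Nonempty) (a : Bool) :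
    prob (fun x => (a ^^ parity S x) = true) = 1 / 2 := by
  obtain ⟨v, hv⟩ := hS
  have h1 := prob_comp_bijective (flipVote_bijective v) fun x => (a ^^ parity S x) = true
  have h2 := prob_not fun x => (a ^^ parity S x) = true
  have h3 : prob (fun x => (a ^^ parity S (flipVote v x)) = true)
      = prob fun x => ¬ (a ^^ parity S x) = true :=
    prob_congr fun x => by simp [parity_flipVote, hv]
  linarith

lemma prob_allYes (S : Finset (Fin n)) :
    prob (fun x => allYes S x = true) = (1 / 2) ^ S.card := by
  have h0 : prob (fun b : Bool => b = true) = 1 / 2 := by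
    simp [prob, uniformProb_eq, Finset.filter_eq']
  have h := prob_pi fun (v : Fin n) (b : Bool) => v ∈ S → b = true
  rw [prob_congr fun x : Fin n → Bool =>
    (show allYes S x = true ↔ ∀ v, v ∈ S → x v = true by simp [allYes]), h]
  rw [← Finset.prod_subset (Finset.subset_univ S), ← Finset.prod_const]
  · refine Finset.prod_congr rfl fun v hv => ?_
    simp only [hv, true_imp_iff, h0]
  · intro v _ hv
    simp only [hv, false_imp_iff, prob_true]

end Influence

/-! ### Approximate solutions of a conjunction -/

section Conjunction

variable {n : ℕ} {ι : Type*} [DecidableEq ι]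

/-- The votes `Y` on the issues in `ι` with the vote of voter `v` on issue `i` negated. -/
def flipIssue (i : ι) (v : Fin n) (Y : ι → Fin n → Bool) : ι → Fin n → Bool :=
  Function.update Y i (flipVote v (Y i))

lemma flipIssue_bijective (i : ι) (v : Fin n) :
    Function.Bijective (flipIssue (ι := ι) i v) :=
  Function.Involutive.bijective fun Y => by simp [flipIssue, flipVote_flipVote]

lemma flipIssue_self (i : ι) (v : Fin n) (Y : ι → Fin n → Bool) :
    flipIssue i v Y i = flipVote v (Y i) := by simp [flipIssue]

lemma flipIssue_of_ne {i l : ι} (h : l ≠ i) (v : Fin n) (Y : ι → Fin n → Bool) :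
    flipIssue i v Y l = Y l := by simp [flipIssue, h]

variable [Fintype ι]

lemma prob_coordinate (i : ι) (E : (Fin n → Bool) → Prop) :
    prob (fun Y : ι → Fin n → Bool => E (Y i)) = prob E := by
  have h := prob_pi fun (l : ι) (x : Fin n → Bool) => l = i → E x
  rw [← Finset.mul_prod_erase _ _ (Finset.mem_univ i), Finset.prod_eq_one, mul_one] at h
  · rw [prob_congr fun Y : ι → Fin n → Bool =>
      (show E (Y i) ↔ ∀ l, l = i → E (Y l) by simp), h]
    exact prob_congr fun x => by simp
  · intro l hl
    have hl' : l ≠ i := Finset.ne_of_mem_erase hl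
    simp only [hl', false_imp_iff, prob_true]

/-- If voter `v` rejects issue `i'`, then negating the vote of `v` on issue `i` does not change the
votes on the conjunction, so it must not change the outcome on issue `i` when all other issues of
the conjunction are accepted. These events are independent. -/
lemma influence_mul_prob_mul_pow_le {F : ι → (Fin n → Bool) → Bool}
    {F₀ : (Fin n → Bool) → Bool} {J : Finset ι} {η δ : ℝ} (hη : 0 ≤ η) (hη1 : η ≤ 1)
    (hF : ∀ i ∈ J, η ≤ prob fun x => F i x = true)
    (hbad : prob (fun Y : ι → Fin n → Bool =>
      F₀ (fun v => allYes J fun i => Y i v) ≠ allYes J fun i => F i (Y i)) ≤ δ)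
    {i i' : ι} (hi : i ∈ J) (hi' : i' ∈ J) (hne : i ≠ i') (v : Fin n) :
    influence (F i) v * prob (fun x => x v = false ∧ F i' x = true) * η ^ Fintype.card ι
      ≤ 2 * δ := by
  set B := fun Y : ι → Fin n → Bool =>
      F₀ (fun v => allYes J fun i => Y i v) ≠ allYes J fun i => F i (Y i) with hB
  -- The outcome on `i` is sensitive to `v`, voter `v` rejects `i'`, all other issues are accepted.
  set E := fun (l : ι) (x : Fin n → Bool) => (l = i → F l x ≠ F l (flipVote v x)) ∧
    (l = i' → x v = false) ∧ (l ∈ J → l ≠ i → F l x = true) with hE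
  have hprod : prob (E i) * (prob (E i') * ∏ l ∈ (Finset.univ.erase i).erase i', prob (E l))
      = prob fun Y : ι → Fin n → Bool => ∀ l, E l (Y l) := by
    rw [prob_pi, ← Finset.mul_prod_erase _ (fun l => prob (E l)) (Finset.mem_univ i),
      ← Finset.mul_prod_erase _ (fun l => prob (E l))
        (show i' ∈ Finset.univ.erase i by simp [hne.symm])]
  have h1 : prob (E i) = influence (F i) v := prob_congr fun x => by simp [hE, hne]
  have h2 : prob (E i') = prob fun x => x v = false ∧ F i' x = true :=
    prob_congr fun x => by simp [hE, hne.symm, hi']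
  have h3 : η ^ Fintype.card ι ≤ ∏ l ∈ (Finset.univ.erase i).erase i', prob (E l) := by
    refine le_trans (pow_le_pow_of_le_one hη hη1 (Finset.card_le_univ
      ((Finset.univ.erase i).erase i'))) ?_
    rw [← Finset.prod_const]
    refine Finset.prod_le_prod (fun _ _ => hη) fun l hl => ?_
    simp only [Finset.mem_erase, Finset.mem_univ, and_true] at hl
    by_cases hlJ : l ∈ J
    · exact (hF l hlJ).trans (prob_mono fun x hx => by simp [hE, hl.1, hl.2, hx])
    · rw [prob_congr (E' := fun _ => True) fun x => by simp [hE, hl.1, hl.2, hlJ], prob_true]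
      exact hη1
  have hsub : prob (fun Y : ι → Fin n → Bool => ∀ l, E l (Y l)) ≤
      prob B + prob fun Y => B (flipIssue i v Y) := by
    refine le_trans (prob_mono fun Y hY => ?_) (prob_or_le _ _)
    by_contra hcon
    simp only [hB, ne_eq, not_or, not_not] at hcon
    obtain ⟨hc1, hc2⟩ := hcon
    have hv : Y i' v = false := (hY i').2.1 rfl
    have hvotes : (fun u => allYes J fun l => flipIssue i v Y l u)
        = fun u => allYes J fun l => Y l u := by
      funext u
      by_cases hu : u = v
      · subst hu
        have e1 : ¬ ∀ l ∈ J, flipIssue i u Y l u = true := fun h => by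
          have := h i' hi'
          rw [flipIssue_of_ne hne.symm, hv] at this
          exact absurd this (by simp)
        have e2 : ¬ ∀ l ∈ J, Y l u = true := fun h => by
          have := h i' hi'
          rw [hv] at this
          exact absurd this (by simp)
        simp [allYes, e1, e2]
      · congr 1
        funext l
        by_cases hl : l = i
        · subst hl; rw [flipIssue_self, flipVote_of_ne hu]
        · rw [flipIssue_of_ne hl]
    rw [hvotes, hc1] at hc2
    have hout : ∀ b : ι → Bool, (∀ l ∈ J, l ≠ i → b l = true) → allYes J b = b i := by
      intro b hb
      unfold allYes
      cases hbi : b i with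
      | false => simpa using ⟨i, hi, hbi⟩
      | true =>
        simp only [decide_eq_true_eq]
        intro l hl
        by_cases hli : l = i
        · rw [hli, hbi]
        · exact hb l hl hli
    rw [hout _ fun l hl hli => (hY l).2.2 hl hli, hout _ fun l hl hli => by
      rw [flipIssue_of_ne hli]; exact (hY l).2.2 hl hli, flipIssue_self] at hc2
    exact (hY i).1 rfl hc2
  rw [prob_comp_bijective (flipIssue_bijective i v) B] at hsub
  rw [← hprod, h1, h2, ← mul_assoc] at hsub
  have h4 : 0 ≤ influence (F i) v * prob fun x => x v = false ∧ F i' x = true :=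
    mul_nonneg (influence_nonneg _ _) (prob_nonneg _)
  calc _ ≤ _ := mul_le_mul_of_nonneg_left h3 h4
    _ ≤ _ := hsub
    _ ≤ 2 * δ := by linarith

/-- A voter whose rejection almost forces a rejection is influential. -/
lemma prob_le_influence_add (f : (Fin n → Bool) → Bool) (v : Fin n) :
    (prob fun x => f x = true) ≤
      influence f v + 2 * prob fun x => x v = false ∧ f x = true := by
  have h1 := prob_comp_bijective (flipVote_bijective v) fun x => x v = false ∧ f x = true
  have h2 : (prob fun x => f x = true) ≤
      prob (fun x => f x ≠ f (flipVote v x)) + (prob (fun x => x v = false ∧ f x = true) +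
        prob fun x => flipVote v x v = false ∧ f (flipVote v x) = true) := by
    refine le_trans (prob_mono fun x hx => ?_)
      (le_trans (prob_or_le _ _) (add_le_add_right (prob_or_le _ _) _))
    by_cases hv : x v = false
    · exact Or.inr (Or.inl ⟨hv, hx⟩)
    · by_cases hf : f x = f (flipVote v x)
      · right; right
        rw [flipVote_self, ← hf]
        exact ⟨by simpa using hv, hx⟩
      · exact Or.inl hf
  unfold influence
  linarith

/-- A function that rejects whenever a member of `S` rejects, up to a small error, and that is
hardly influenced by the others, is close to the oligarchy `S`. -/
lemma prob_ne_allYes_le {f : (Fin n → Bool) → Bool} {S : Finset (Fin n)} {η : ℝ} (hn : 1 ≤ n)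
    (hη : 0 < η) (hf : η ≤ prob fun x => f x = true)
    (hS : ∀ v ∈ S, (n : ℝ) * prob (fun x => x v = false ∧ f x = true) ≤ η / 8)
    (hS' : ∀ v, v ∉ S → influence f v ≤ η ^ 2 / (16 * n)) :
    (prob fun x => f x ≠ allYes S x) ≤ η / 4 := by
  have hn0 : (0 : ℝ) < n := by exact_mod_cast hn
  set A := prob fun x => ∃ v ∈ S, x v = false ∧ f x = true with hA
  set a := prob fun x => (∀ v ∈ S, x v = true) ∧ f x = true with ha
  set b := prob fun x => (∀ v ∈ S, x v = true) ∧ f x = false with hb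
  have hA' : A ≤ η / 8 := by
    calc A ≤ ∑ v ∈ S, prob fun x => x v = false ∧ f x = true := prob_exists_le _ _
      _ ≤ ∑ v ∈ S, η / 8 / n := Finset.sum_le_sum fun v hv => by
          rw [le_div_iff₀ hn0, mul_comm]; exact hS v hv
      _ = S.card * (η / 8 / n) := by simp
      _ ≤ n * (η / 8 / n) := by
          have : S.card ≤ n := by simpa using Finset.card_le_univ S
          gcongr
      _ = η / 8 := by field_simp
  have hfa : η ≤ A + a := by
    refine hf.trans (le_trans (prob_mono fun x hx => ?_) (prob_or_le _ _))
    by_cases h : ∀ v ∈ S, x v = true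
    · exact Or.inr ⟨h, hx⟩
    · push Not at h
      obtain ⟨v, hv, hxv⟩ := h
      exact Or.inl ⟨v, hv, by simpa using hxv, hx⟩
  have hab : a * b ≤ η ^ 2 / 16 := by
    refine (prob_mul_prob_le_of_influence_le f S (by positivity) hS').trans (le_of_eq ?_)
    field_simp
  have hb0 : 0 ≤ b := prob_nonneg _
  have hb' : b ≤ η / 8 := by
    have : η / 2 * b ≤ η / 2 * (η / 8) := by nlinarith
    exact le_of_mul_le_mul_left this (by positivity)
  have : (prob fun x => f x ≠ allYes S x) ≤ A + b := by
    refine le_trans (prob_mono fun x hx => ?_) (prob_or_le _ _)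
    cases hfx : f x with
    | true =>
      rw [hfx] at hx
      left
      by_contra hcon
      push Not at hcon
      exact hx (by simpa [allYes] using fun v hv => by simpa using fun h => hcon v hv h rfl)
    | false =>
      rw [hfx] at hx
      exact Or.inr ⟨by simpa [allYes] using hx.symm, rfl⟩
  linarith

/-- If independent mechanisms `F i`, none of them nearly constantly `false`, almost commute with a
conjunction of at least two issues, then they are all close to one oligarchy. -/
theorem exists_forall_prob_ne_allYes_le (hn : 1 ≤ n) {F : ι → (Fin n → Bool) → Bool}
    {F₀ : (Fin n → Bool) → Bool} {J : Finset ι} (hJ : 2 ≤ J.card) {η δ : ℝ} (hη : 0 < η)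
    (hη1 : η ≤ 1) (hδ : 256 * (n : ℝ) ^ 2 * δ ≤ η ^ (Fintype.card ι + 3))
    (hF : ∀ i ∈ J, η ≤ prob fun x => F i x = true)
    (hbad : prob (fun Y : ι → Fin n → Bool =>
      F₀ (fun v => allYes J fun i => Y i v) ≠ allYes J fun i => F i (Y i)) ≤ δ) :
    ∃ S, ∀ i ∈ J, influential (η ^ 2 / (16 * n)) (F i) = S ∧
      (prob fun x => F i x ≠ allYes S x) ≤ η / 4 := by
  have hn0 : (0 : ℝ) < n := by exact_mod_cast hn
  have hn1 : (1 : ℝ) ≤ n := by exact_mod_cast hn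
  set τ := η ^ 2 / (16 * n) with hτ
  -- A voter who is influential on one premise almost has a veto on every other premise.
  have hq : ∀ i ∈ J, ∀ i' ∈ J, i ≠ i' → ∀ v ∈ influential τ (F i),
      (n : ℝ) * prob (fun x => x v = false ∧ F i' x = true) ≤ η / 8 := by
    intro i hi i' hi' hne v hv
    have h1 := influence_mul_prob_mul_pow_le hη.le hη1 hF hbad hi hi' hne v
    have hP : 0 < η ^ Fintype.card ι := by positivity
    rw [pow_add] at hδ
    set P := η ^ Fintype.card ι
    set q := prob fun x => x v = false ∧ F i' x = true
    have hq0 : 0 ≤ q := prob_nonneg _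
    have h2 : τ * q * P ≤ 2 * δ := by
      refine le_trans ?_ h1
      have := (mem_influential.1 hv).le
      gcongr
    have h3 : η ^ 2 * (q * P) ≤ 32 * n * δ := by
      have : τ * q * P * (16 * n) = η ^ 2 * (q * P) := by rw [hτ]; field_simp
      nlinarith
    have h4 : η ^ 2 * P * (n * q) ≤ η ^ 2 * P * (η / 8) := by nlinarith
    exact le_of_mul_le_mul_left h4 (by positivity)
  -- As `F i'` accepts with probability at least `η`, a voter with a veto on it is influential.
  have hsub : ∀ i ∈ J, ∀ i' ∈ J, i ≠ i' → influential τ (F i) ⊆ influential τ (F i') := by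
    intro i hi i' hi' hne v hv
    rw [mem_influential]
    have h1 := hq i hi i' hi' hne v hv
    have h2 := prob_le_influence_add (F i') v
    have h3 := hF i' hi'
    have hq0 : 0 ≤ prob fun x => x v = false ∧ F i' x = true := prob_nonneg _
    have h4 : τ < η / 2 := by
      rw [hτ, div_lt_div_iff₀ (by positivity) (by norm_num)]
      nlinarith
    nlinarith
  obtain ⟨i₀, hi₀⟩ : J.Nonempty := Finset.card_pos.1 (by omega)
  refine ⟨influential τ (F i₀), fun i hi => ?_⟩
  have heq : influential τ (F i) = influential τ (F i₀) := by
    by_cases h : i = i₀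
    · rw [h]
    · exact Finset.Subset.antisymm (hsub i hi i₀ hi₀ h) (hsub i₀ hi₀ i hi (Ne.symm h))
  refine ⟨heq, ?_⟩
  obtain ⟨l, hl, hli⟩ := Finset.exists_mem_ne (by omega : 1 < J.card) i
  rw [← heq]
  refine prob_ne_allYes_le hn hη (hF i hi) (fun v hv => ?_) fun v hv => ?_
  · exact hq l hl i hi hli v (hsub i hi l hl hli.symm hv)
  · exact not_lt.1 fun h => hv (mem_influential.2 h)

end Conjunction

/-! ### Approximate solutions of a xor -/

section Xor

variable {n : ℕ} {ι : Type*} [DecidableEq ι]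

lemma parity_single {J : Finset ι} {i : ι} (hi : i ∈ J) (b : Bool) :
    parity J (fun l => decide (l = i) && b) = b := by
  unfold parity
  cases b with
  | false => simp
  | true => simp [Finset.filter_eq', hi]

variable [Fintype ι]

lemma prob_coordinate_pair {i i' : ι} (hne : i ≠ i') (E E' : (Fin n → Bool) → Prop) :
    prob (fun Y : ι → Fin n → Bool => E (Y i) ∧ E' (Y i')) = prob E * prob E' := by
  have h := prob_pi fun (l : ι) (x : Fin n → Bool) => (l = i → E x) ∧ (l = i' → E' x)
  rw [← Finset.mul_prod_erase _ _ (Finset.mem_univ i),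
    ← Finset.mul_prod_erase _ _ (show i' ∈ Finset.univ.erase i by simp [hne.symm]),
    Finset.prod_eq_one, mul_one] at h
  · have h1 : prob (fun Y : ι → Fin n → Bool => E (Y i) ∧ E' (Y i'))
        = prob fun Y : ι → Fin n → Bool => ∀ l, (l = i → E (Y l)) ∧ (l = i' → E' (Y l)) :=
      prob_congr fun Y => ⟨fun hY l => ⟨fun hl => hl ▸ hY.1, fun hl => hl ▸ hY.2⟩,
        fun hY => ⟨(hY i).1 rfl, (hY i').2 rfl⟩⟩
    rw [h1, h]
    congr 1
    · exact prob_congr fun x => by simp [hne]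
    · exact prob_congr fun x => by simp [hne.symm]
  · intro l hl
    simp only [Finset.mem_erase, Finset.mem_univ, and_true] at hl
    simp only [hl.1, hl.2, false_imp_iff, and_true, prob_true]

/-- Negating the vote of `v` on two issues of a xor does not change the votes on the xor, so the
outcomes on the two issues must change simultaneously. These changes are independent. -/
lemma influence_mul_one_sub_le {F : ι → (Fin n → Bool) → Bool} {F₀ : (Fin n → Bool) → Bool}
    {J : Finset ι} {δ : ℝ}
    (hbad : prob (fun Y : ι → Fin n → Bool =>
      F₀ (fun v => parity J fun i => Y i v) ≠ parity J fun i => F i (Y i)) ≤ δ)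
    {i i' : ι} (hi : i ∈ J) (hi' : i' ∈ J) (hne : i ≠ i') (v : Fin n) :
    influence (F i) v * (1 - influence (F i') v) ≤ 2 * δ := by
  set B := fun Y : ι → Fin n → Bool =>
      F₀ (fun v => parity J fun i => Y i v) ≠ parity J fun i => F i (Y i) with hB
  unfold influence
  rw [← prob_not, ← prob_coordinate_pair hne]
  have hbij := (flipIssue_bijective i v).comp (flipIssue_bijective i' v)
  have h1 := prob_comp_bijective hbij B
  have h2 : prob (fun Y : ι → Fin n → Bool => F i (Y i) ≠ F i (flipVote v (Y i)) ∧
      ¬ F i' (Y i') ≠ F i' (flipVote v (Y i'))) ≤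
      prob B + prob fun Y => B ((flipIssue i v ∘ flipIssue i' v) Y) := by
    refine le_trans (prob_mono fun Y hY => ?_) (prob_or_le _ _)
    by_contra hcon
    simp only [hB, ne_eq, not_or, not_not] at hcon
    obtain ⟨hc1, hc2⟩ := hcon
    set Y' := (flipIssue i v ∘ flipIssue i' v) Y with hY'
    have hYi : Y' i = flipVote v (Y i) := by
      simp [hY', flipIssue_self, flipIssue_of_ne hne]
    have hYi' : Y' i' = flipVote v (Y i') := by
      simp [hY', flipIssue_self, flipIssue_of_ne hne.symm]
    have hYl : ∀ l, l ≠ i → l ≠ i' → Y' l = Y l := fun l h h' => by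
      simp [hY', flipIssue_of_ne h, flipIssue_of_ne h']
    have hvotes : (fun u => parity J fun l => Y' l u) = fun u => parity J fun l => Y l u := by
      funext u
      have : (fun l => Y' l u) = fun l =>
          (decide (l = i) && decide (u = v)) ^^ ((decide (l = i') && decide (u = v)) ^^ Y l u) := by
        funext l
        by_cases h : l = i
        · subst h
          rw [hYi]
          by_cases hu : u = v
          · subst hu; simp [flipVote_self, hne]
          · simp [flipVote_of_ne hu, hu]
        · by_cases h' : l = i'
          · subst h'
            rw [hYi']
            by_cases hu : u = v
            · subst hu; simp [flipVote_self, h]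
            · simp [flipVote_of_ne hu, hu]
          · simp [hYl l h h', h, h']
      rw [this, parity_xor, parity_xor, parity_single hi, parity_single hi']
      simp
    have hout : (fun l => F l (Y' l)) = fun l =>
        (decide (l = i) && (F i (Y i) ^^ F i (flipVote v (Y i)))) ^^
          ((decide (l = i') && (F i' (Y i') ^^ F i' (flipVote v (Y i')))) ^^ F l (Y l)) := by
      funext l
      by_cases h : l = i
      · subst h
        rw [hYi]
        simp [hne, Bool.xor_comm]
      · by_cases h' : l = i'
        · subst h'
          rw [hYi']
          simp [h, Bool.xor_comm]
        · simp [hYl l h h', h, h']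
    rw [hvotes, hc1, hout, parity_xor, parity_xor, parity_single hi, parity_single hi',
      not_not.1 hY.2] at hc2
    refine hY.1 ?_
    generalize (parity J fun l => F l (Y l)) = p at hc2
    revert hc2
    cases p <;> cases F i (Y i) <;> cases F i (flipVote v (Y i)) <;> simp
  linarith

lemma influence_xor_parity (f : (Fin n → Bool) → Bool) (S : Finset (Fin n)) (v : Fin n) :
    influence (fun x => f x ^^ parity S x) v
      = if v ∈ S then 1 - influence f v else influence f v := by
  unfold influence
  split_ifs with hv
  · rw [← prob_not]
    refine prob_congr fun x => ?_
    simp only [parity_flipVote]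
    cases f x <;> cases f (flipVote v x) <;> cases parity S x <;> simp [hv]
  · refine prob_congr fun x => ?_
    simp only [parity_flipVote]
    cases f x <;> cases f (flipVote v x) <;> cases parity S x <;> simp [hv]

/-- If all influences on `f` are close to `0` or to `1`, then `f` is close to a xor of votes, up to
negation. -/
lemma exists_prob_ne_parity_le {f : (Fin n → Bool) → Bool} {S : Finset (Fin n)} {c : ℝ}
    (hc : 0 ≤ c) (hS : ∀ v ∈ S, 1 - influence f v ≤ c) (hS' : ∀ v, v ∉ S → influence f v ≤ c) :
    ∃ a, (prob fun x => f x ≠ (a ^^ parity S x)) ≤ 2 * (n * c) := by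
  have h := prob_mul_prob_le_of_influence_le (fun x => f x ^^ parity S x) ∅ hc fun v _ => by
    rw [influence_xor_parity]
    split_ifs with hv
    exacts [hS v hv, hS' v hv]
  simp only [Finset.notMem_empty, false_imp_iff, implies_true, true_and] at h
  have e0 : prob (fun x => (f x ^^ parity S x) = true)
      = prob fun x => f x ≠ (false ^^ parity S x) :=
    prob_congr fun x => by cases f x <;> cases parity S x <;> simp
  have e1 : prob (fun x => (f x ^^ parity S x) = false)
      = prob fun x => f x ≠ (true ^^ parity S x) :=
    prob_congr fun x => by cases f x <;> cases parity S x <;> simp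
  have e2 := prob_not fun x => (f x ^^ parity S x) = true
  have e3 : prob (fun x => ¬ (f x ^^ parity S x) = true)
      = prob fun x => (f x ^^ parity S x) = false := prob_congr fun x => by simp
  rw [e3] at e2
  have h0 : 0 ≤ prob (fun x => (f x ^^ parity S x) = true) := prob_nonneg _
  have h1 : 0 ≤ prob (fun x => (f x ^^ parity S x) = false) := prob_nonneg _
  by_cases hle : prob (fun x => (f x ^^ parity S x) = true) ≤ 1 / 2
  · exact ⟨false, by rw [← e0]; nlinarith⟩
  · exact ⟨true, by rw [← e1]; nlinarith⟩

/-- If independent mechanisms `F i` almost commute with a xor of at least two issues, then they are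
all close, up to negation, to the xor of the votes of one set of voters. -/
theorem exists_forall_prob_ne_parity_le (hn : 1 ≤ n) {F : ι → (Fin n → Bool) → Bool}
    {F₀ : (Fin n → Bool) → Bool} {J : Finset ι} (hJ : 2 ≤ J.card) {η δ : ℝ} (hη : 0 < η)
    (hη1 : η ≤ 1) (hδ : 256 * (n : ℝ) ^ 2 * δ ≤ η ^ (Fintype.card ι + 3))
    (hbad : prob (fun Y : ι → Fin n → Bool =>
      F₀ (fun v => parity J fun i => Y i v) ≠ parity J fun i => F i (Y i)) ≤ δ) :
    ∃ S, ∀ i ∈ J, influential (η ^ 2 / (16 * n)) (F i) = S ∧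
      ∃ a, (prob fun x => F i x ≠ (a ^^ parity S x)) ≤ η / 4 := by
  have hn0 : (0 : ℝ) < n := by exact_mod_cast hn
  have hn1 : (1 : ℝ) ≤ n := by exact_mod_cast hn
  have hδ0 : 0 ≤ δ := (prob_nonneg _).trans hbad
  have hδn : 256 * (n * δ) ≤ η ^ 2 := by
    have h1 : η ^ (Fintype.card ι + 3) ≤ η ^ 2 := pow_le_pow_of_le_one hη.le hη1 (by omega)
    have h2 : 0 ≤ n * δ := by positivity
    nlinarith
  set τ := η ^ 2 / (16 * n) with hτ
  have hτ1 : 4 * δ ≤ τ := by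
    rw [hτ, le_div_iff₀ (by positivity)]
    nlinarith
  have hτ2 : τ < 1 / 2 := by
    rw [hτ, div_lt_div_iff₀ (by positivity) (by norm_num)]
    nlinarith
  -- Two independent events that nearly coincide are both nearly impossible or both nearly certain.
  have hdich : ∀ i ∈ J, ∀ i' ∈ J, i ≠ i' → ∀ v,
      (influence (F i) v ≤ 4 * δ ∧ influence (F i') v ≤ 4 * δ) ∨
      (1 - influence (F i) v ≤ 4 * δ ∧ 1 - influence (F i') v ≤ 4 * δ) := by
    intro i hi i' hi' hne v
    have h1 := influence_mul_one_sub_le hbad hi hi' hne v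
    have h2 := influence_mul_one_sub_le hbad hi' hi hne.symm v
    have p0 := influence_nonneg (F i) v
    have q0 := influence_nonneg (F i') v
    have p1 : influence (F i) v ≤ 1 := prob_le_one _
    have q1 : influence (F i') v ≤ 1 := prob_le_one _
    by_cases hq : influence (F i') v ≤ 1 / 2
    · have hp : influence (F i) v ≤ 4 * δ := by nlinarith
      exact Or.inl ⟨hp, by nlinarith⟩
    · have hp : 1 - influence (F i) v ≤ 4 * δ := by nlinarith
      exact Or.inr ⟨hp, by nlinarith⟩
  have hsub : ∀ i ∈ J, ∀ i' ∈ J, i ≠ i' → influential τ (F i) ⊆ influential τ (F i') := by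
    intro i hi i' hi' hne v hv
    rw [mem_influential] at hv ⊢
    rcases hdich i hi i' hi' hne v with h | h <;> linarith
  obtain ⟨i₀, hi₀⟩ : J.Nonempty := Finset.card_pos.1 (by omega)
  refine ⟨influential τ (F i₀), fun i hi => ?_⟩
  have heq : influential τ (F i) = influential τ (F i₀) := by
    by_cases h : i = i₀
    · rw [h]
    · exact Finset.Subset.antisymm (hsub i hi i₀ hi₀ h) (hsub i₀ hi₀ i hi (Ne.symm h))
  refine ⟨heq, ?_⟩
  obtain ⟨l, hl, hli⟩ := Finset.exists_mem_ne (by omega : 1 < J.card) i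
  rw [← heq]
  obtain ⟨a, ha⟩ := exists_prob_ne_parity_le (f := F i) (S := influential τ (F i))
    (c := 4 * δ) (by positivity)
    (fun v hv => by
      rw [mem_influential] at hv
      rcases hdich i hi l hl hli.symm v with h | h <;> linarith)
    (fun v hv => by
      rw [mem_influential] at hv
      rcases hdich i hi l hl hli.symm v with h | h <;> linarith)
  exact ⟨a, ha.trans (by nlinarith)⟩

end Xor

/-! ### Rounding a mechanism for one issue -/

section Rounding

variable {n : ℕ}

/-- The mechanism that `f` becomes when both the votes and the outcome are negated if
`b = true`. -/
def twist (b : Bool) (f : (Fin n → Bool) → Bool) : (Fin n → Bool) → Bool :=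
  fun x => b ^^ f fun v => b ^^ x v

lemma negateVotes_bijective {κ : Type*} (b : κ → Bool) :
    Function.Bijective fun (x : κ → Bool) v => b v ^^ x v :=
  Function.Involutive.bijective fun x => by funext v; simp

lemma influence_twist (b : Bool) (f : (Fin n → Bool) → Bool) (v : Fin n) :
    influence (twist b f) v = influence f v := by
  unfold influence
  rw [← prob_comp_bijective (negateVotes_bijective fun _ => b) fun x => f x ≠ f (flipVote v x)]
  refine prob_congr fun x => ?_
  have h : (fun u => b ^^ flipVote v x u) = flipVote v fun u => b ^^ x u := by
    funext u
    by_cases hu : u = v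
    · subst hu; simp [flipVote_self]
    · simp [flipVote_of_ne hu]
  simp only [twist, h]
  simp

lemma influential_twist (τ : ℝ) (b : Bool) (f : (Fin n → Bool) → Bool) :
    influential τ (twist b f) = influential τ f := by
  ext v
  rw [mem_influential, mem_influential, influence_twist]

lemma prob_twist_eq (b c : Bool) (f : (Fin n → Bool) → Bool) :
    (prob fun x => twist b f x = c) = prob fun x => f x = (b ^^ c) := by
  rw [← prob_comp_bijective (negateVotes_bijective fun _ => b) fun x => f x = (b ^^ c)]
  refine prob_congr fun x => ?_
  unfold twist
  cases b <;> cases c <;> simp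

lemma prob_twist_ne (b : Bool) (f g : (Fin n → Bool) → Bool) :
    (prob fun x => twist b f x ≠ g x) = prob fun x => f x ≠ twist b g x := by
  rw [← prob_comp_bijective (negateVotes_bijective fun _ => b) fun x => f x ≠ twist b g x]
  refine prob_congr fun x => ?_
  unfold twist
  cases b <;> simp

lemma prob_eq_not (f : (Fin n → Bool) → Bool) (a : Bool) :
    (prob fun x => f x = !a) = 1 - prob fun x => f x = a := by
  rw [← prob_not]
  exact prob_congr fun x => by cases f x <;> cases a <;> simp

lemma prob_eq_le_add (f g : (Fin n → Bool) → Bool) (a : Bool) :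
    (prob fun x => f x = a) ≤ (prob fun x => g x = a) + prob fun x => f x ≠ g x := by
  refine le_trans (prob_mono fun x hx => ?_) (prob_or_le _ _)
  by_cases h : f x = g x
  · exact Or.inl (h ▸ hx)
  · exact Or.inr h

/-- The mechanisms for one issue, determined by a set `S` of voters, that can solve a conjunction or
a xor without being constant: the conjunction and the disjunction of the votes of the members of
`S`, and the xor of these votes and its negation. -/
def IsBasic (S : Finset (Fin n)) (h : (Fin n → Bool) → Bool) : Prop :=
  (∃ b, h = twist b (allYes S)) ∨ ∃ a, h = fun x => a ^^ parity S x

lemma IsBasic.eq_parity_of_card_eq_one {S : Finset (Fin n)} (hS : S.card = 1)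
    {h : (Fin n → Bool) → Bool} (hh : IsBasic S h) : ∃ a, h = fun x => a ^^ parity S x := by
  rcases hh with ⟨b, rfl⟩ | hh
  · obtain ⟨v, rfl⟩ := Finset.card_eq_one.1 hS
    refine ⟨false, ?_⟩
    funext x
    have h1 : parity {v} x = x v := by
      unfold parity
      cases hx : x v <;> simp [Finset.filter_singleton, hx]
    cases b <;> cases hx : x v <;> simp [twist, allYes, h1, hx]
  · exact hh

lemma prob_allYes_le {S : Finset (Fin n)} {k : ℕ} (hS : k ≤ S.card) :
    (prob fun x => allYes S x = true) ≤ (1 / 2) ^ k := by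
  rw [prob_allYes]
  exact pow_le_pow_of_le_one (by norm_num) (by norm_num) hS

/-- Two basic mechanisms with the same set of voters are far from each other: their probabilities
of accepting tell them apart, unless they are negations of each other. -/
lemma IsBasic.eq_of_prob_ne_lt {S : Finset (Fin n)} (hS : S.Nonempty)
    {h h' : (Fin n → Bool) → Bool} (hh : IsBasic S h) (hh' : IsBasic S h')
    (hd : (prob fun x => h x ≠ h' x) < 1 / 4) : h = h' := by
  have hpar : ∀ a a' : Bool, (prob fun x : Fin n → Bool =>
      (a ^^ parity S x) ≠ (a' ^^ parity S x)) < 1 / 4 → a = a' := by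
    intro a a' hlt
    by_contra hne
    rw [prob_congr (E' := fun _ => True) fun x => by simp [hne], prob_true] at hlt
    norm_num at hlt
  by_cases hcard : S.card = 1
  · obtain ⟨a, rfl⟩ := hh.eq_parity_of_card_eq_one hcard
    obtain ⟨a', rfl⟩ := hh'.eq_parity_of_card_eq_one hcard
    rw [hpar a a' hd]
  have hcard2 : 2 ≤ S.card := by
    have := hS.card_pos
    omega
  have hquarter := prob_allYes_le hcard2
  have htrue := prob_twist_eq true true (allYes S)
  have hfalse := prob_twist_eq false true (allYes S)
  have hnot := prob_eq_not (allYes S) true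
  simp only [Bool.bne_true, Bool.not_true, Bool.not_false] at htrue hfalse hnot
  have hd' : (prob fun x => h' x ≠ h x) < 1 / 4 := by
    rwa [prob_congr fun x => (ne_comm : h' x ≠ h x ↔ h x ≠ h' x)]
  have h1 := prob_eq_le_add h h' true
  have h2 := prob_eq_le_add h' h true
  rcases hh with ⟨b, rfl⟩ | ⟨a, rfl⟩ <;> rcases hh' with ⟨b', rfl⟩ | ⟨a', rfl⟩
  · cases b <;> cases b'
    · rfl
    · exfalso; linarith
    · exfalso; linarith
    · rfl
  · have h3 := prob_parity hS a'
    cases b <;> (exfalso; linarith)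
  · have h3 := prob_parity hS a
    cases b' <;> (exfalso; linarith)
  · rw [hpar a a' hd]

open Classical in
/-- Rounding of a mechanism `f` for one issue: to a constant if `f` is `η`-close to it, otherwise to
a close basic mechanism whose members are the influential voters; `f` itself if there is none. -/
noncomputable def round (η : ℝ) (f : (Fin n → Bool) → Bool) : (Fin n → Bool) → Bool :=
  if (prob fun x => f x = true) ≤ η then fun _ => false
  else if (prob fun x => f x = false) ≤ η then fun _ => true
  else if h : ∃ g, IsBasic (influential (η ^ 2 / (16 * n)) f) g ∧
    (prob fun x => f x ≠ g x) ≤ η / 4 then h.choose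
  else f

variable {η : ℝ} {f : (Fin n → Bool) → Bool}

lemma prob_ne_round_le (hη : 0 ≤ η) (f : (Fin n → Bool) → Bool) :
    (prob fun x => f x ≠ round η f x) ≤ η := by
  unfold round
  split_ifs with h1 h2 h3
  · simpa using h1
  · simpa using h2
  · exact h3.choose_spec.2.trans (by linarith)
  · simpa [prob_false] using hη

lemma round_eq_const (hη : η ≤ 1 / 4) {a : Bool} (h : (prob fun x => f x = !a) ≤ η) :
    round η f = fun _ => a := by
  unfold round
  cases a with
  | false => rw [if_pos (by simpa using h)]
  | true =>
    have h1 := prob_eq_not f true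
    simp only [Bool.not_true] at h h1
    rw [if_neg (by linarith), if_pos h]

lemma round_eq_basic (hη : η ≤ 1 / 4) {h : (Fin n → Bool) → Bool}
    (htrue : η < prob fun x => f x = true) (hfalse : η < prob fun x => f x = false)
    (hS : (influential (η ^ 2 / (16 * n)) f).Nonempty)
    (hh : IsBasic (influential (η ^ 2 / (16 * n)) f) h)
    (hd : (prob fun x => f x ≠ h x) ≤ η / 4) : round η f = h := by
  have hex : ∃ g, IsBasic (influential (η ^ 2 / (16 * n)) f) g ∧
    (prob fun x => f x ≠ g x) ≤ η / 4 := ⟨h, hh, hd⟩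
  unfold round
  rw [if_neg (not_le.2 htrue), if_neg (not_le.2 hfalse), dif_pos hex]
  obtain ⟨hg, hgd⟩ := hex.choose_spec
  refine hg.eq_of_prob_ne_lt hS hh ?_
  have : (prob fun x => hex.choose x ≠ h x) ≤
      (prob fun x => f x ≠ hex.choose x) + prob fun x => f x ≠ h x := by
    refine le_trans (prob_mono fun x hx => ?_) (prob_or_le _ _)
    by_contra hcon
    push Not at hcon
    exact hx (hcon.1.symm.trans hcon.2)
  have hη0 : 0 ≤ η / 4 := (prob_nonneg _).trans hd
  linarith

lemma twist_round_eq_allYes (hη0 : 0 < η) (hη : η ≤ 1 / 4) {b : Bool} {S : Finset (Fin n)}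
    (hS : influential (η ^ 2 / (16 * n)) (twist b f) = S)
    (hb : η < prob fun x => twist b f x = true)
    (hd : (prob fun x => twist b f x ≠ allYes S x) ≤ η / 4) :
    twist b (round η f) = allYes S := by
  rcases S.eq_empty_or_nonempty with rfl | hne
  · have h1 : (prob fun x => f x = !(!b)) ≤ η := by
      have h2 : (prob fun x => twist b f x ≠ allYes ∅ x) = prob fun x => f x = !(!b) := by
        have := prob_twist_eq b false f
        simp only [Bool.bne_false] at this
        rw [Bool.not_not, ← this]
        exact prob_congr fun x => by simp [allYes]
      linarith
    rw [round_eq_const hη h1]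
    funext x
    simp [twist, allYes]
  · have hf1 : (prob fun x => f x = !b) = prob fun x => twist b f x = true := by
      have := prob_twist_eq b true f
      simp only [Bool.bne_true] at this
      exact this.symm
    have h1 := prob_eq_le_add (twist b f) (allYes S) true
    have h2 := prob_allYes_le (S := S) (k := 1) hne.card_pos
    have h3 := prob_eq_not f b
    rw [influential_twist] at hS
    have h4 : round η f = twist b (allYes S) := by
      refine round_eq_basic hη ?_ ?_ (hS ▸ hne) (hS ▸ Or.inl ⟨b, rfl⟩)
        (by rwa [← prob_twist_ne])
      · cases b <;> simp only [Bool.not_true, Bool.not_false] at hf1 h3 <;> linarith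
      · cases b <;> simp only [Bool.not_true, Bool.not_false] at hf1 h3 <;> linarith
    rw [h4]
    funext x
    simp [twist]

lemma round_eq_parity (hη0 : 0 < η) (hη : η ≤ 1 / 4) {a : Bool} {S : Finset (Fin n)}
    (hS : influential (η ^ 2 / (16 * n)) f = S)
    (hd : (prob fun x => f x ≠ (a ^^ parity S x)) ≤ η / 4) :
    round η f = fun x => a ^^ parity S x := by
  rcases S.eq_empty_or_nonempty with rfl | hne
  · have h1 : (prob fun x => f x = !a) ≤ η := by
      have h2 : (prob fun x => f x ≠ (a ^^ parity ∅ x)) = prob fun x => f x = !a :=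
        prob_congr fun x => by cases f x <;> cases a <;> simp [parity]
      linarith
    rw [round_eq_const hη h1]
    funext x
    simp [parity]
  · have h1 := prob_eq_le_add f (fun x => a ^^ parity S x) true
    have h2 := prob_parity hne a
    have h3 := prob_eq_not f true
    have h4 := prob_eq_le_add f (fun x => a ^^ parity S x) false
    have h5 := prob_eq_not (fun x => a ^^ parity S x) true
    simp only [Bool.not_true] at h3 h5
    exact round_eq_basic hη (by linarith) (by linarith) (hS ▸ hne) (hS ▸ Or.inr ⟨a, rfl⟩) hd

end Rounding

/-! ### Rounding the premises preserves the conclusions -/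

section Conclusions

variable {n : ℕ} {ι : Type*}

lemma isConjunction_iff_allYes {φ : (ι → Bool) → Bool} : IsConjunction φ ↔
    ∃ (J : Finset ι) (neg : ι → Bool) (out : Bool), J.Nonempty ∧
      ∀ y, φ y = (out ^^ allYes J fun i => neg i ^^ y i) := Iff.rfl

lemma IsXor.exists_eq_parity {φ : (ι → Bool) → Bool} (hφ : IsXor φ) :
    ∃ (J : Finset ι) (c : Bool), J.Nonempty ∧ ∀ y, φ y = (c ^^ parity J y) := by
  obtain ⟨J, neg, out, hJ, hφ⟩ := hφ
  refine ⟨J, out ^^ parity J neg, hJ, fun y => ?_⟩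
  rw [hφ, Bool.xor_assoc, ← parity_xor]
  rfl

lemma exists_eq_of_single {φ : (ι → Bool) → Bool} {i : ι} {c : Bool}
    (hφ : ∀ y, φ y = (c ^^ y i)) (g : ι → (Fin n → Bool) → Bool) :
    ∃ ψ : (Fin n → Bool) → Bool, ∀ Y : ι → Fin n → Bool,
      (φ fun i => g i (Y i)) = ψ fun v => φ fun i => Y i v :=
  ⟨fun w => c ^^ g i fun v => c ^^ w v, fun Y => by simp [hφ]⟩

variable [Fintype ι] [DecidableEq ι] {η δ : ℝ} {φ : (ι → Bool) → Bool}
  {f : ι → (Fin n → Bool) → Bool} {f₀ : (Fin n → Bool) → Bool}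

/-- After rounding, the outcome on a conjunction is a function of the votes on the conjunction. -/
theorem IsConjunction.exists_round_eq (hφ : IsConjunction φ) (hn : 1 ≤ n) (hη : 0 < η)
    (hη1 : η ≤ 1 / 4) (hδ : 256 * (n : ℝ) ^ 2 * δ ≤ η ^ (Fintype.card ι + 3))
    (hbad : prob (fun Y : ι → Fin n → Bool =>
      f₀ (fun v => φ fun i => Y i v) ≠ φ fun i => f i (Y i)) ≤ δ) :
    ∃ ψ : (Fin n → Bool) → Bool, ∀ Y : ι → Fin n → Bool,
      (φ fun i => round η (f i) (Y i)) = ψ fun v => φ fun i => Y i v := by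
  obtain ⟨J, neg, out, hJ, hφ⟩ := isConjunction_iff_allYes.1 hφ
  by_cases hcard : J.card = 1
  · obtain ⟨i, rfl⟩ := Finset.card_eq_one.1 hcard
    exact exists_eq_of_single (i := i) (c := out ^^ neg i)
      (fun y => by
        rw [hφ]
        cases out <;> cases h : neg i <;> cases h' : y i <;> simp [allYes, h, h']) _
  have hJ2 : 2 ≤ J.card := by
    have := hJ.card_pos
    omega
  by_cases hconst : ∃ i ∈ J, (prob fun x => twist (neg i) (f i) x = true) ≤ η
  · -- A premise that is rounded to rejection makes the conjunction constant.
    obtain ⟨i, hi, hle⟩ := hconst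
    rw [prob_twist_eq, Bool.xor_true] at hle
    refine ⟨fun _ => out, fun Y => ?_⟩
    have : allYes J (fun i => neg i ^^ round η (f i) (Y i)) = false := by
      simp only [allYes, decide_eq_false_iff_not, not_forall]
      exact ⟨i, hi, by simp [round_eq_const hη1 hle]⟩
    rw [hφ, this, Bool.xor_false]
  push Not at hconst
  have hbij : Function.Bijective fun (Y : ι → Fin n → Bool) i v => neg i ^^ Y i v :=
    Function.Involutive.bijective fun Y => by funext i v; simp
  rw [← prob_comp_bijective hbij] at hbad
  obtain ⟨S, hS⟩ := exists_forall_prob_ne_allYes_le hn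
    (F := fun i => twist (neg i) (f i)) (F₀ := twist out f₀) hJ2 hη (by linarith) hδ
    (fun i hi => (hconst i hi).le) (le_trans (prob_mono fun Y hY => by
      simp only [hφ] at *
      intro h
      refine hY ?_
      simp only [twist]
      simp only [← Bool.xor_assoc, Bool.xor_self, Bool.false_xor] at h
      rw [h, ← Bool.xor_assoc, Bool.xor_self, Bool.false_xor]) hbad)
  refine ⟨twist out (allYes S), fun Y => ?_⟩
  have hround : ∀ i ∈ J, (neg i ^^ round η (f i) (Y i)) = allYes S fun v => neg i ^^ Y i v := by
    intro i hi
    have h := twist_round_eq_allYes hη hη1 (hS i hi).1 (hconst i hi) (hS i hi).2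
    rw [← h]
    simp [twist]
  simp only [hφ, twist]
  congr 1
  have hall : (allYes J fun i => neg i ^^ round η (f i) (Y i))
      = allYes J fun i => allYes S fun v => neg i ^^ Y i v :=
    decide_eq_decide.2 (forall₂_congr fun i hi => Iff.of_eq (congrArg (· = true) (hround i hi)))
  rw [hall, Bool.eq_iff_iff]
  simp only [allYes, decide_eq_true_eq, ← Bool.xor_assoc, Bool.xor_self, Bool.false_xor]
  exact ⟨fun h v hv i hi => h i hi v hv, fun h i hi v hv => h v hv i hi⟩

/-- After rounding, the outcome on a xor is a function of the votes on the xor. -/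
theorem IsXor.exists_round_eq (hφ : IsXor φ) (hn : 1 ≤ n) (hη : 0 < η)
    (hη1 : η ≤ 1 / 4) (hδ : 256 * (n : ℝ) ^ 2 * δ ≤ η ^ (Fintype.card ι + 3))
    (hbad : prob (fun Y : ι → Fin n → Bool =>
      f₀ (fun v => φ fun i => Y i v) ≠ φ fun i => f i (Y i)) ≤ δ) :
    ∃ ψ : (Fin n → Bool) → Bool, ∀ Y : ι → Fin n → Bool,
      (φ fun i => round η (f i) (Y i)) = ψ fun v => φ fun i => Y i v := by
  obtain ⟨J, c, hJ, hφ⟩ := hφ.exists_eq_parity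
  by_cases hcard : J.card = 1
  · obtain ⟨i, rfl⟩ := Finset.card_eq_one.1 hcard
    refine exists_eq_of_single (i := i) (c := c) (fun y => ?_) _
    rw [hφ]
    congr 1
    apply toZMod_injective
    simp [toZMod_parity]
  have hJ2 : 2 ≤ J.card := by
    have := hJ.card_pos
    omega
  obtain ⟨S, hS⟩ := exists_forall_prob_ne_parity_le hn (F := f) (F₀ := twist c f₀) hJ2 hη
    (by linarith) hδ (le_trans (prob_mono fun Y hY => by
      simp only [hφ] at *
      intro h
      refine hY ?_
      simp only [twist]
      rw [h]
      simp) hbad)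
  have hround : ∀ i, ∃ a, i ∈ J → round η (f i) = fun x => a ^^ parity S x := by
    intro i
    by_cases hi : i ∈ J
    · obtain ⟨hSi, a, ha⟩ := hS i hi
      exact ⟨a, fun _ => round_eq_parity hη hη1 hSi ha⟩
    · exact ⟨false, fun h => absurd h hi⟩
  choose a ha using hround
  refine ⟨fun w => c ^^ (parity J a ^^ parity S fun v => c ^^ w v), fun Y => ?_⟩
  simp only [hφ, ← Bool.xor_assoc, Bool.xor_self, Bool.false_xor]
  rw [Bool.xor_assoc, ← parity_comm, ← parity_xor]
  congr 1
  apply toZMod_injective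
  rw [toZMod_parity, toZMod_parity]
  exact Finset.sum_congr rfl fun i hi => by rw [ha i hi]

end Conclusions

/-! ### Truth-functional agendas -/

section Agenda

variable {m n : ℕ} {A : Agenda m} {P : Finset (Fin m)} {Φ : Fin m → ({i // i ∈ P} → Bool) → Bool}

/-- The opinion on all issues that is determined by the opinion `y` on the premises. -/
def extend (Φ : Fin m → ({i // i ∈ P} → Bool) → Bool) (y : {i // i ∈ P} → Bool) : Opinion m :=
  fun j => if h : j ∈ P then y ⟨j, h⟩ else Φ j y

lemma extend_premise (y : {i // i ∈ P} → Bool) (i : {i // i ∈ P}) : extend Φ y i = y i := by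
  simp [extend]

lemma extend_conclusion (y : {i // i ∈ P} → Bool) {j : Fin m} (hj : j ∉ P) :
    extend Φ y j = Φ j y := by
  simp [extend, hj]

lemma extend_mem (hA : ∀ x : Opinion m, x ∈ A ↔ ∀ j, j ∉ P → x j = Φ j fun i => x i)
    (y : {i // i ∈ P} → Bool) : extend Φ y ∈ A := by
  rw [hA]
  intro j hj
  rw [extend_conclusion y hj]
  congr 1
  funext i
  rw [extend_premise]

lemma eq_extend (hA : ∀ x : Opinion m, x ∈ A ↔ ∀ j, j ∉ P → x j = Φ j fun i => x i)
    {x : Opinion m} (hx : x ∈ A) : x = extend Φ fun i => x i := by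
  funext j
  by_cases hj : j ∈ P
  · exact (extend_premise (fun i => x i) ⟨j, hj⟩).symm
  · rw [extend_conclusion _ hj, (hA x).1 hx j hj]

/-- The profile in which the voters vote according to `Y` on the premises. -/
def profileOf (Φ : Fin m → ({i // i ∈ P} → Bool) → Bool) (Y : {i // i ∈ P} → Fin n → Bool) :
    Profile m n := fun v => extend Φ fun i => Y i v

lemma mem_profiles {X : Profile m n} : X ∈ profiles A n ↔ ∀ v, X v ∈ A := by
  simp [profiles]

lemma profileOf_mem (hA : ∀ x : Opinion m, x ∈ A ↔ ∀ j, j ∉ P → x j = Φ j fun i => x i)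
    (Y : {i // i ∈ P} → Fin n → Bool) : profileOf Φ Y ∈ profiles A n :=
  mem_profiles.2 fun _ => extend_mem hA _

/-- In a truth-functional agenda, the votes on the premises are independent and uniform. -/
lemma uniformProb_profiles_eq_prob
    (hA : ∀ x : Opinion m, x ∈ A ↔ ∀ j, j ∉ P → x j = Φ j fun i => x i)
    (E : Profile m n → Prop) :
    uniformProb (profiles A n) E
      = prob fun Y : {i // i ∈ P} → Fin n → Bool => E (profileOf Φ Y) := by
  refine uniformProb_of_bijOn (S := Finset.univ) ⟨fun Y _ => profileOf_mem hA Y, ?_, ?_⟩ E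
  · intro Y _ Y' _ h
    funext i v
    rw [← extend_premise (Φ := Φ) (fun i => Y i v) i, ← extend_premise (Φ := Φ) (fun i => Y' i v) i]
    exact congrFun (congrFun h v) i
  · intro X hX
    exact ⟨fun i v => X v i, by simp,
      funext fun v => (eq_extend hA (mem_profiles.1 hX v)).symm⟩

lemma mechDist_nonneg (A : Agenda m) (F G : Mechanism m n) : 0 ≤ mechDist A F G :=
  uniformProb_nonneg _ _

lemma mechDist_self (A : Agenda m) (F : Mechanism m n) : mechDist A F F = 0 := by
  unfold mechDist
  simpa using uniformProb_false (profiles A n)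

lemma mechDist_le_one (A : Agenda m) (F G : Mechanism m n) : mechDist A F G ≤ 1 :=
  uniformProb_le_one _ _

lemma mechDist_triangle (A : Agenda m) (F G H : Mechanism m n) :
    mechDist A F H ≤ mechDist A F G + mechDist A G H := by
  refine le_trans (uniformProb_mono fun X _ hX => ?_) (uniformProb_or_le _ _ _)
  by_contra hcon
  push Not at hcon
  exact hX (hcon.1.trans hcon.2)

lemma inconsistencyIndex_le_add (A : Agenda m) (F H : Mechanism m n) :
    inconsistencyIndex A H ≤ inconsistencyIndex A F + mechDist A F H := by
  refine le_trans (uniformProb_mono fun X _ hX => ?_) (uniformProb_or_le _ _ _)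
  by_cases h : F X = H X
  · exact Or.inl (h ▸ hX)
  · exact Or.inr h

/-- An independent mechanism is given by one function of the votes for each issue. -/
lemma IsIndependent.exists_eq {H : Mechanism m n} (hH : IsIndependent A H) :
    ∃ f : Fin m → (Fin n → Bool) → Bool, ∀ X ∈ profiles A n, ∀ j,
      H X j = f j fun v => X v j := by
  classical
  refine ⟨fun j w => if h : ∃ X ∈ profiles A n, (fun v => X v j) = w then H h.choose j
    else false, fun X hX j => ?_⟩
  have hex : ∃ X' ∈ profiles A n, (fun v => X' v j) = fun v => X v j := ⟨X, hX, rfl⟩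
  simp only [dif_pos hex]
  exact hH X hX _ hex.choose_spec.1 j fun v => (congrFun hex.choose_spec.2 v).symm

/-- An independent mechanism that is nearly consistent is close to a consistent and independent
mechanism, which rounds the mechanism on the premises and derives the conclusions. -/
lemma exists_mechDist_le_of_isIndependent (hA : IsConjXorAgenda A) (hn : 1 ≤ n) {η : ℝ}
    (hη : 0 < η) (hη1 : η ≤ 1 / 4) {H : Mechanism m n} (hH : IsIndependent A H)
    (hIC : 256 * (n : ℝ) ^ 2 * inconsistencyIndex A H ≤ η ^ (m + 2)) :
    ∃ G : Mechanism m n, IsConsistent A G ∧ IsIndependent A G ∧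
      mechDist A H G ≤ inconsistencyIndex A H + m * η := by
  obtain ⟨P, Φ, hΦ, hA⟩ := hA
  obtain ⟨f, hf⟩ := hH.exists_eq
  have hcardP : Fintype.card {i // i ∈ P} = P.card := Fintype.card_coe P
  have hH' : ∀ (Y : {i // i ∈ P} → Fin n → Bool) (i : {i // i ∈ P}),
      H (profileOf Φ Y) i = f i (Y i) := fun Y i => by
    rw [hf _ (profileOf_mem hA Y)]
    simp only [profileOf, extend_premise]
  have hbad : ∀ j, j ∉ P → prob (fun Y : {i // i ∈ P} → Fin n → Bool =>
      f j (fun v => Φ j fun i => Y i v) ≠ Φ j fun i => f i (Y i)) ≤ inconsistencyIndex A H := by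
    intro j hj
    unfold inconsistencyIndex
    rw [uniformProb_profiles_eq_prob hA]
    refine prob_mono fun Y hY hmem => hY ?_
    have h1 := (hA _).1 hmem j hj
    rw [hf _ (profileOf_mem hA Y)] at h1
    simp only [hH', profileOf, extend_conclusion _ hj] at h1
    exact h1
  have hψ : ∀ j, j ∉ P → ∃ ψ : (Fin n → Bool) → Bool, ∀ Y : {i // i ∈ P} → Fin n → Bool,
      (Φ j fun i => round η (f i) (Y i)) = ψ fun v => Φ j fun i => Y i v := by
    intro j hj
    -- As `j` is not a premise, there are at most `m - 1` premises.
    have hlt : P.card < m := by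
      simpa using Finset.card_lt_univ_of_notMem hj
    have hδ : 256 * (n : ℝ) ^ 2 * inconsistencyIndex A H
        ≤ η ^ (Fintype.card {i // i ∈ P} + 3) :=
      hIC.trans (pow_le_pow_of_le_one hη.le (by linarith) (by omega))
    rcases hΦ j hj with h | h
    · exact h.exists_round_eq hn hη hη1 hδ (hbad j hj)
    · exact h.exists_round_eq hn hη hη1 hδ (hbad j hj)
  refine ⟨fun X => extend Φ fun i => round η (f i) fun v => X v i,
    fun X _ => extend_mem hA _, fun X hX Y hY j hXY => ?_, ?_⟩
  · by_cases hj : j ∈ P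
    · simp only [extend, dif_pos hj, hXY]
    · obtain ⟨ψ, hψ⟩ := hψ j hj
      dsimp only
      rw [extend_conclusion _ hj, extend_conclusion _ hj, hψ fun i v => X v i,
        hψ fun i v => Y v i]
      congr 1
      funext v
      rw [← (hA _).1 (mem_profiles.1 hX v) j hj, ← (hA _).1 (mem_profiles.1 hY v) j hj, hXY]
  · have hclose : ∀ i : {i // i ∈ P}, prob (fun Y : {i // i ∈ P} → Fin n → Bool =>
        f i (Y i) ≠ round η (f i) (Y i)) ≤ η := fun i =>
      (prob_coordinate i fun x => f i x ≠ round η (f i) x).le.trans (prob_ne_round_le hη.le _)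
    unfold mechDist inconsistencyIndex
    rw [uniformProb_profiles_eq_prob hA, uniformProb_profiles_eq_prob hA]
    refine le_trans (prob_mono fun Y hY => ?_) (le_trans (prob_or_le
      (fun Y : {i // i ∈ P} → Fin n → Bool => H (profileOf Φ Y) ∉ A)
      fun Y => ∃ i ∈ (Finset.univ : Finset {i // i ∈ P}), f i (Y i) ≠ round η (f i) (Y i)) ?_)
    · by_contra hcon
      simp only [not_or, not_not, Finset.mem_univ, true_and, not_exists] at hcon
      obtain ⟨hmem, hround⟩ := hcon
      refine hY ?_
      rw [eq_extend hA hmem]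
      congr 1
      funext i
      rw [hH', hround i]
      simp only [profileOf, extend_premise]
    · gcongr
      refine (prob_exists_le _ _).trans ((Finset.sum_le_sum fun i _ => hclose i).trans ?_)
      have hle : P.card ≤ m := by simpa using Finset.card_le_univ P
      simp only [Finset.sum_const, nsmul_eq_mul, Finset.card_univ, hcardP]
      gcongr

/-- The rounding threshold is `η = ε / (2 * m)`: half of `ε` is spent on rounding at most `m`
premises. -/
theorem exists_mechDist_lt_of_isIndependent (hA : IsConjXorAgenda A) (hm : 2 ≤ m) (hn : 1 ≤ n)
    {ε : ℝ} (hε : 0 < ε) (hε1 : ε ≤ 1) {H : Mechanism m n} (hH : IsIndependent A H)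
    (hIC : inconsistencyIndex A H
      ≤ (n : ℝ) ^ (-2 : ℤ) * (ε / (5 * (m : ℝ))) ^ (m ^ 2 + m - 1)) :
    ∃ G : Mechanism m n, IsConsistent A G ∧ IsIndependent A G ∧ mechDist A H G < ε := by
  have hn1 : (1 : ℝ) ≤ n := by exact_mod_cast hn
  have hm2 : (2 : ℝ) ≤ m := by exact_mod_cast hm
  have hη : 0 < ε / (2 * m) := by positivity
  have hη1 : ε / (2 * m) ≤ 1 / 4 := by
    rw [div_le_div_iff₀ (by positivity) (by norm_num)]
    linarith
  have hεη : ε / (5 * m) = 2 / 5 * (ε / (2 * m)) := by field_simp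
  have hm' : m * (ε / (2 * m)) = ε / 2 := by field_simp
  rw [hεη] at hIC
  set η := ε / (2 * m)
  have hpow : 256 * (2 / 5 * η) ^ (m ^ 2 + m - 1) ≤ η ^ (m + 2) := by
    calc 256 * (2 / 5 * η) ^ (m ^ 2 + m - 1) ≤ 256 * (2 / 5 * η) ^ (m + 3) := by
          gcongr 256 * ?_
          exact pow_le_pow_of_le_one (by positivity) (by linarith) (by
            have : 2 * 2 ≤ m * m := Nat.mul_le_mul hm hm
            rw [pow_two]
            omega)
      _ = 256 * (2 / 5) ^ (m + 3) * η * η ^ (m + 2) := by rw [mul_pow]; ring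
      _ ≤ 256 * (2 / 5) ^ 5 * (1 / 4) * η ^ (m + 2) := by
          gcongr 256 * ?_ * ?_ * _
          exact pow_le_pow_of_le_one (by norm_num) (by norm_num) (by omega)
      _ ≤ 1 * η ^ (m + 2) := by gcongr; norm_num
      _ = η ^ (m + 2) := one_mul _
  have hIC' : 256 * (n : ℝ) ^ 2 * inconsistencyIndex A H ≤ η ^ (m + 2) := by
    refine le_trans ?_ hpow
    have h1 : (n : ℝ) ^ 2 * inconsistencyIndex A H ≤ (2 / 5 * η) ^ (m ^ 2 + m - 1) := by
      refine (mul_le_mul_of_nonneg_left hIC (by positivity)).trans (le_of_eq ?_)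
      rw [← mul_assoc, zpow_neg, zpow_ofNat, mul_inv_cancel₀ (by positivity), one_mul]
    linarith
  obtain ⟨G, hG, hG', hd⟩ := exists_mechDist_le_of_isIndependent hA hn hη hη1 hH hIC'
  refine ⟨G, hG, hG', hd.trans_lt ?_⟩
  have h0 : 0 ≤ inconsistencyIndex A H := uniformProb_nonneg _ _
  have h1 : η ^ (m + 2) ≤ η := pow_le_of_le_one hη.le (by linarith) (by omega)
  have h2 : inconsistencyIndex A H ≤ (n : ℝ) ^ 2 * inconsistencyIndex A H :=
    le_mul_of_one_le_left h0 (one_le_pow₀ hn1)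
  nlinarith

end Agenda

/-! ### From nearly independent to independent mechanisms -/

section Independence

variable {m n : ℕ} {A : Agenda m}

/-- The majority outcome of `F` on issue `j` among the consistent profiles that agree with `X` on
this issue. -/
noncomputable def majorityOutcome (A : Agenda m) (F : Mechanism m n) : Mechanism m n := fun X j =>
  decide (((profiles A n).filter fun Y => ∀ i, X i j = Y i j).card ≤
    2 * (((profiles A n).filter fun Y => ∀ i, X i j = Y i j).filter fun Y => F Y j = true).card)

lemma isIndependent_majorityOutcome (A : Agenda m) (F : Mechanism m n) :
    IsIndependent A (majorityOutcome A F) := by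
  intro X _ Y _ j h
  simp only [majorityOutcome, h]

/-- If `F X` is not the majority outcome, then at least half of the profiles that agree with `X`
have a different outcome. -/
lemma half_le_uniformProb_of_ne_majorityOutcome {F : Mechanism m n} {X : Profile m n}
    (hX : X ∈ profiles A n) {j : Fin m} (hne : F X j ≠ majorityOutcome A F X j) :
    1 ≤ 2 * uniformProb ((profiles A n).filter fun Y => ∀ i, X i j = Y i j)
      fun Y => F X j ≠ F Y j := by
  unfold majorityOutcome at hne
  rw [uniformProb_eq]
  set S := (profiles A n).filter fun Y => ∀ i, X i j = Y i j with hS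
  have hpos : (0 : ℝ) < S.card := by
    have : X ∈ S := by simp [hS, hX]
    exact_mod_cast Finset.card_pos.2 ⟨X, this⟩
  rw [← mul_div_assoc, le_div_iff₀ hpos, one_mul]
  have hsum := Finset.card_filter_add_card_filter_not (s := S) fun Y => F Y j = true
  cases hF : F X j with
  | true =>
    rw [hF] at hne
    have h1 : ¬ S.card ≤ 2 * (S.filter fun Y => F Y j = true).card := by simpa using hne
    have h2 : (S.filter fun Y => true ≠ F Y j) = S.filter fun Y => ¬ F Y j = true :=
      Finset.filter_congr fun Y _ => by simp
    rw [h2]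
    exact_mod_cast (by omega : S.card ≤ 2 * (S.filter fun Y => ¬ F Y j = true).card)
  | false =>
    rw [hF] at hne
    have h1 : S.card ≤ 2 * (S.filter fun Y => F Y j = true).card := by simpa using hne
    have h2 : (S.filter fun Y => false ≠ F Y j) = S.filter fun Y => F Y j = true :=
      Finset.filter_congr fun Y _ => by simp
    rw [h2]
    exact_mod_cast h1

lemma mechDist_majorityOutcome_le (A : Agenda m) (F : Mechanism m n) :
    mechDist A F (majorityOutcome A F) ≤ 2 * m * dependencyIndex A F := by
  have hissue : ∀ j, uniformProb (profiles A n) (fun X => F X j ≠ majorityOutcome A F X j)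
      ≤ 2 * dependencyIndex A F := by
    intro j
    have h1 : issueDependencyIndex A F j ≤ dependencyIndex A F :=
      le_ciSup (f := fun j => issueDependencyIndex A F j) (Set.finite_range _).bddAbove j
    refine le_trans ?_ (mul_le_mul_of_nonneg_left h1 zero_le_two)
    unfold issueDependencyIndex
    rw [uniformProb_eq, ← mul_div_assoc]
    gcongr
    rw [Finset.card_filter, Nat.cast_sum, Finset.mul_sum]
    refine Finset.sum_le_sum fun X hX => ?_
    split_ifs with hne
    · rw [Nat.cast_one]
      exact half_le_uniformProb_of_ne_majorityOutcome hX hne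
    · rw [Nat.cast_zero]
      exact mul_nonneg zero_le_two (uniformProb_nonneg _ _)
  calc mechDist A F (majorityOutcome A F)
      ≤ uniformProb (profiles A n)
          fun X => ∃ j ∈ Finset.univ, F X j ≠ majorityOutcome A F X j :=
        uniformProb_mono fun X _ hX => by
          obtain ⟨j, hj⟩ := Function.ne_iff.1 hX
          exact ⟨j, Finset.mem_univ j, hj⟩
    _ ≤ ∑ j, uniformProb (profiles A n) fun X => F X j ≠ majorityOutcome A F X j :=
        uniformProb_exists_le _ _ _
    _ ≤ ∑ _j : Fin m, 2 * dependencyIndex A F := Finset.sum_le_sum fun j _ => hissue j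
    _ = 2 * m * dependencyIndex A F := by
        simp only [Finset.sum_const, Finset.card_univ, Fintype.card_fin, nsmul_eq_mul]
        ring

lemma IsAlmostIndependent.exists_mechDist_le (hm : 1 ≤ m) {δ : ℝ} {F : Mechanism m n}
    (hF : IsAlmostIndependent A δ F) :
    ∃ H : Mechanism m n, IsIndependent A H ∧ mechDist A F H ≤ 2 * m * δ := by
  have hm1 : (1 : ℝ) ≤ m := by exact_mod_cast hm
  rcases hF with hF | ⟨H, hH, hd⟩
  · exact ⟨_, isIndependent_majorityOutcome A F,
      (mechDist_majorityOutcome_le A F).trans (by gcongr)⟩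
  · have h0 := (mechDist_nonneg A F H).trans hd
    exact ⟨H, hH, hd.trans (by nlinarith)⟩

/-- On a single issue there are no conclusions, so every mechanism is consistent and independent. -/
lemma isConsistent_and_isIndependent_of_one {A : Agenda 1} (hA : IsConjXorAgenda A)
    (F : Mechanism 1 n) : IsConsistent A F ∧ IsIndependent A F := by
  obtain ⟨P, Φ, hΦ, hA⟩ := hA
  have hP : ∀ j, j ∈ P := by
    intro j
    by_contra hj
    have hne : Nonempty {i // i ∈ P} := by
      rcases hΦ j hj with ⟨S, _, _, ⟨i, _⟩, _⟩ | ⟨S, _, _, ⟨i, _⟩, _⟩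
      exacts [⟨i⟩, ⟨i⟩]
    obtain ⟨i, hi⟩ := hne
    exact hj (Subsingleton.elim i j ▸ hi)
  refine ⟨fun X _ => (hA _).2 fun j hj => absurd (hP j) hj, fun X _ Y _ j h => ?_⟩
  have : X = Y := by
    funext i k
    rw [Subsingleton.elim k j, h i]
  rw [this]

lemma exists_isConsistent_and_isIndependent (hA : IsConjXorAgenda A) :
    ∃ G : Mechanism m n, IsConsistent A G ∧ IsIndependent A G := by
  obtain ⟨P, Φ, _, hA⟩ := hA
  exact ⟨fun _ => extend Φ fun _ => false, fun _ _ => extend_mem hA _, fun _ _ _ _ _ _ => rfl⟩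

/-- Passing from `F` to an independent mechanism costs `α` twice: once as additional inconsistency
and once as distance from `F`. -/
lemma exists_mechDist_lt_of_almost (hA : IsConjXorAgenda A) (hm : 2 ≤ m) (hn : 1 ≤ n)
    {ε α δ δ' : ℝ} (hε : 0 < ε) (hε1 : ε ≤ 1) {F : Mechanism m n}
    (hα : 2 * m * δ' ≤ α)
    (hδ : δ + α ≤ (n : ℝ) ^ (-2 : ℤ) * (ε / (5 * (m : ℝ))) ^ (m ^ 2 + m - 1))
    (hF : IsAlmostConsistent A δ F) (hF' : IsAlmostIndependent A δ' F) :
    ∃ G : Mechanism m n, IsConsistent A G ∧ IsIndependent A G ∧ mechDist A F G < α + ε := by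
  obtain ⟨H, hH, hd⟩ := hF'.exists_mechDist_le (by omega)
  have hIC : inconsistencyIndex A H ≤ δ + α :=
    (inconsistencyIndex_le_add A F H).trans (add_le_add hF (hd.trans hα))
  obtain ⟨G, hG, hG', hd'⟩ :=
    exists_mechDist_lt_of_isIndependent hA hm hn hε hε1 hH (hIC.trans hδ)
  exact ⟨G, hG, hG', (mechDist_triangle A F H G).trans_lt
    (add_lt_add_of_le_of_lt (hd.trans hα) hd')⟩

/-- A single issue leaves no room for conclusions, and distances are at most `1`. -/
lemma exists_mechDist_lt_of_trivial (hA : IsConjXorAgenda A) (hm : 1 ≤ m) {ε : ℝ} (hε : 0 < ε)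
    (h : ¬ (2 ≤ m ∧ ε ≤ 1)) (F : Mechanism m n) :
    ∃ G : Mechanism m n, IsConsistent A G ∧ IsIndependent A G ∧ mechDist A F G < ε := by
  by_cases hm1 : m = 1
  · subst hm1
    obtain ⟨h1, h2⟩ := isConsistent_and_isIndependent_of_one hA F
    exact ⟨F, h1, h2, by rwa [mechDist_self]⟩
  · obtain ⟨G, h1, h2⟩ := exists_isConsistent_and_isIndependent (n := n) hA
    have hε1 : 1 < ε := by
      by_contra hcon
      exact h ⟨by omega, not_lt.1 hcon⟩
    exact ⟨G, h1, h2, (mechDist_le_one A F G).trans_lt hε1⟩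

lemma polynomial_bounds (hm : 2 ≤ m) {ε : ℝ} (hε : 0 < ε) (hε1 : ε ≤ 1) :
    (2 * m + 1) * (ε / m) ^ (5 * m ^ 2 + 5 * m + 3)
      ≤ (ε / 2 / (5 * m)) ^ (m ^ 2 + m - 1) ∧
    2 * m * (ε / m) ^ (5 * m ^ 2 + 5 * m + 3) ≤ ε / 2 := by
  have hm2 : (2 : ℝ) ≤ m := by exact_mod_cast hm
  have hr : 0 < ε / m := by positivity
  have hr1 : ε / m ≤ 1 / 2 := by
    rw [div_le_div_iff₀ (by positivity) (by norm_num)]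
    linarith
  have hmr : m * (ε / m) = ε := by field_simp
  have h10 : ε / 2 / (5 * m) = ε / m / 10 := by field_simp; norm_num
  rw [h10]
  set r := ε / m
  have hr2 : r ^ 2 ≤ (1 / 2) ^ 2 := by gcongr
  constructor
  · have h1 : r ^ (5 * m ^ 2 + 5 * m + 3) ≤ r ^ (5 * (m ^ 2 + m - 1) + 3) :=
      pow_le_pow_of_le_one hr.le (by linarith) (by omega)
    have h2 : (r ^ 5) ^ (m ^ 2 + m - 1) ≤ (r / 10) ^ (m ^ 2 + m - 1) := by
      have h3 : r ^ 4 ≤ (1 / 2) ^ 4 := by gcongr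
      gcongr
      nlinarith
    have h3 : (2 * m + 1) * r ^ 3 ≤ 1 := by
      have : (2 * m + 1) * r ≤ 3 := by nlinarith
      have := mul_le_mul this hr2 (by positivity) (by norm_num)
      nlinarith
    calc (2 * m + 1) * r ^ (5 * m ^ 2 + 5 * m + 3)
        ≤ (2 * m + 1) * r ^ (5 * (m ^ 2 + m - 1) + 3) := by gcongr
      _ = (2 * m + 1) * r ^ 3 * (r ^ 5) ^ (m ^ 2 + m - 1) := by rw [pow_add, pow_mul]; ring
      _ ≤ 1 * (r / 10) ^ (m ^ 2 + m - 1) := by gcongr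
      _ = _ := one_mul _
  · have h1 : r ^ (5 * m ^ 2 + 5 * m + 3) ≤ r ^ 3 :=
      pow_le_pow_of_le_one hr.le (by linarith) (by omega)
    calc 2 * m * r ^ (5 * m ^ 2 + 5 * m + 3) ≤ 2 * m * r ^ 3 := by gcongr
      _ = 2 * (m * r) * r ^ 2 := by ring
      _ ≤ 2 * ε * (1 / 2) ^ 2 := by rw [hmr]; gcongr
      _ = ε / 2 := by ring

end Independence

end JudgementAggregation

theorem mainTheorem1 :
    (∃ p : Polynomial ℕ, ∀ (ε : ℝ) (m n : ℕ), 0 < ε → 1 ≤ m → 1 ≤ n →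
      ∀ δ : ℝ, δ = (n : ℝ) ^ (-2 : ℤ) * (ε / (m : ℝ)) ^ (p.eval m) →
        ∀ A : JudgementAggregation.Agenda m, JudgementAggregation.IsConjXorAgenda A →
          ∀ F : JudgementAggregation.Mechanism m n,
            JudgementAggregation.IsAlmostConsistent A δ F →
            JudgementAggregation.IsAlmostIndependent A δ F →
              ∃ G : JudgementAggregation.Mechanism m n,
                JudgementAggregation.IsConsistent A G ∧
                JudgementAggregation.IsIndependent A G ∧
                JudgementAggregation.mechDist A F G < ε) ∧
    (∀ (ε : ℝ) (m n : ℕ), 0 < ε → 1 ≤ m → 1 ≤ n →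
      ∀ β : ℝ, 0 ≤ β → β ≤ (n : ℝ) ^ (-2 : ℤ) * (ε / (m : ℝ)) ^ (m ^ 2 + m - 1) →
      ∀ δIC δDI : ℝ,
        δIC = (n : ℝ) ^ (-2 : ℤ) * ((1 - β) * ε / (5 * (m : ℝ))) ^ (m ^ 2 + m - 1) - β * ε →
        δDI = 1 / (2 * (m : ℝ)) * β * ε →
        ∀ A : JudgementAggregation.Agenda m, JudgementAggregation.IsConjXorAgenda A →
          ∀ F : JudgementAggregation.Mechanism m n,
            JudgementAggregation.IsAlmostConsistent A δIC F →
            JudgementAggregation.IsAlmostIndependent A δDI F →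
              ∃ G : JudgementAggregation.Mechanism m n,
                JudgementAggregation.IsConsistent A G ∧
                JudgementAggregation.IsIndependent A G ∧
                JudgementAggregation.mechDist A F G < ε) := by
  have hinv : ∀ n : ℕ, 1 ≤ n → 0 < (n : ℝ) ^ (-2 : ℤ) ∧ (n : ℝ) ^ (-2 : ℤ) ≤ 1 := by
    intro n hn
    have hn1 : (1 : ℝ) ≤ n := by exact_mod_cast hn
    exact ⟨by positivity, zpow_le_one_of_nonpos₀ hn1 (by norm_num)⟩
  constructor
  · refine ⟨5 * Polynomial.X ^ 2 + 5 * Polynomial.X + 3, ?_⟩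
    intro ε m n hε hm hn δ hδ A hA F hF hF'
    by_cases htriv : 2 ≤ m ∧ ε ≤ 1
    swap
    · exact JudgementAggregation.exists_mechDist_lt_of_trivial hA hm hε htriv F
    obtain ⟨hm2, hε1⟩ := htriv
    have heval : (5 * Polynomial.X ^ 2 + 5 * Polynomial.X + 3 : Polynomial ℕ).eval m
        = 5 * m ^ 2 + 5 * m + 3 := by simp
    rw [heval] at hδ
    obtain ⟨hb1, hb2⟩ := JudgementAggregation.polynomial_bounds hm2 hε hε1
    obtain ⟨hn0, hn1⟩ := hinv n hn
    -- Half of `ε` is spent on the distance to an independent mechanism.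
    obtain ⟨G, hG, hG', hd⟩ := JudgementAggregation.exists_mechDist_lt_of_almost hA hm2 hn
      (half_pos hε) (by linarith) le_rfl (by
        calc δ + 2 * m * δ = (n : ℝ) ^ (-2 : ℤ) *
              ((2 * m + 1) * (ε / m) ^ (5 * m ^ 2 + 5 * m + 3)) := by rw [hδ]; ring
          _ ≤ _ := by gcongr) hF hF'
    refine ⟨G, hG, hG', hd.trans_le ?_⟩
    have h1 : 2 * m * δ ≤ ε / 2 := by
      calc 2 * m * δ = (n : ℝ) ^ (-2 : ℤ) *
            (2 * m * (ε / m) ^ (5 * m ^ 2 + 5 * m + 3)) := by rw [hδ]; ring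
        _ ≤ 1 * (ε / 2) := by gcongr
        _ = ε / 2 := one_mul _
    linarith
  · intro ε m n hε hm hn β hβ0 hβ δIC δDI hIC hDI A hA F hF hF'
    by_cases htriv : 2 ≤ m ∧ ε ≤ 1
    swap
    · exact JudgementAggregation.exists_mechDist_lt_of_trivial hA hm hε htriv F
    obtain ⟨hm2, hε1⟩ := htriv
    obtain ⟨hn0, hn1⟩ := hinv n hn
    have hm2' : (2 : ℝ) ≤ m := by exact_mod_cast hm2
    have hr : ε / m ≤ 1 / 2 := by
      rw [div_le_div_iff₀ (by positivity) (by norm_num)]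
      linarith
    have hβ1 : β < 1 := by
      have h1 : (ε / m) ^ (m ^ 2 + m - 1) ≤ ε / m :=
        pow_le_of_le_one (by positivity) (by linarith) (by omega)
      have h2 : 0 ≤ (ε / m) ^ (m ^ 2 + m - 1) := by positivity
      nlinarith
    obtain ⟨G, hG, hG', hd⟩ := JudgementAggregation.exists_mechDist_lt_of_almost hA hm2 hn
      (ε := (1 - β) * ε) (α := β * ε) (mul_pos (by linarith) hε) (by nlinarith)
      (by rw [hDI]; apply le_of_eq; field_simp) (by rw [hIC]; linarith) hF hF'
    exact ⟨G, hG, hG', hd.trans_eq (by ring)⟩
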